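/- Let $p\ge 2$ be an integer and $\mathbb P=\{1,\dots,p-1\}$. Let $G$ be the Vilenkin group of all sequences $x=(x_j)_{j\in\mathbb Z}$ with $x_j\in\{0,\dots,p-1\}$ and $x_j=0$ for all $j<k_x$, for some $k_x\in\mathbb Z$, with coordinatewise addition $\oplus$ modulo $p$ (inverse operation $\ominus$). Let $\rho:G\to G$, $(\rho(x))_j=x_{j+1}$, be the dilation, $\sigma=\rho^{-1}$, $U=\{x\in G: x_j=0 \text{ for } j\le 0\}$ and $\Lambda=\{x\in G: x_j=0\text{ for } j>0\}$. The sets $x\oplus\rho^m(U)$ ($x\in G$, $m\in\mathbb Z$) are a base of the topology of $G$, and $\mu$ is the Haar measure with $\mu(U)=1$. The dual group $G^*$ is the group of the same sequences, with the same topology, maps $\rho,\sigma$ and subgroup $\Lambda$, with $U^*$ defined like $U$ and $\mu^*$ the Haar measure with $\mu^*(U^*)=1$; $\omega\in G^*$ acts as the character $\chi(x,\omega)=\exp\bigl(\frac{2\pi i}{p}\sum_{j\in\mathbb Z}x_{j}\,\omega_{1-j}\bigr)$. For $f\in L^1(G^*)\cap L^2(G^*)$ put $f^\vee(x)=\int_{G^*}f(\omega)\chi(x,\omega)\,d\mu^*(\omega)$,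 and for a function $f$ on $G$, $j\in\mathbb Z$, $n\in\Lambda$ put $f_{j,n}(x)=p^{j/2}f(\rho^j(x)\ominus n)$. Let $\Omega=\{\Omega^{(u)}\}_{u\in\mathbb P}$ be a family of Borel measurable subsets of $G^*$. Call $\Omega$ a wavelet set if every $\Omega^{(u)}$ has finite measure and the family $\bigl\{\bigl((\mathbf 1_{\Omega^{(u)}})^\vee\bigr)_{j,n}\bigr\}_{j\in\mathbb Z,\,n\in\Lambda,\,u\in\mathbb P}$ is an orthonormal basis of $L^2(G)$. **Theorem.** $\Omega$ is a wavelet set if and only if both of the following conditions hold. (i) $\{\sigma^k(\Omega^{(u)})\}_{k\in\mathbb Z,u\in\mathbb P}$ tiles $G^*$ up to null sets: for all $u_1,u_2\in\mathbb P$ and $j,k\in\mathbb Z$ with $u_1\ne u_2$ or $j\ne k$, $$\mu^*\bigl(\sigma^j(\Omega^{(u_1)})\cap\sigma^k(\Omega^{(u_2)})\bigr)=0,\qquad\text{and}\qquad \mu^*\Bigl(G^*\setminus\bigcup_{k\in\mathbb Z,\,u\in\mathbb P}\sigma^k(\Omega^{(u)})\Bigr)=0.$$ (ii) For every $u\in\mathbb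 P$, $\Omega^{(u)}$ is $\Lambda$-translation congruent to $U^*$ up to null sets: there are a set $N^{(u)}\subset\Lambda$ and a partition $\{\Omega_n^{(u)}: n\in N^{(u)}\}$ of $\Omega^{(u)}$ into measurable sets such that $$\mu^*\bigl((\Omega_{n_1}^{(u)}\ominus n_1)\cap(\Omega_{n_2}^{(u)}\ominus n_2)\bigr)=0\quad\text{for all } n_1\ne n_2 \text{ in } N^{(u)},$$ $$\bigcup_{n\in N^{(u)}}(\Omega_n^{(u)}\ominus n)\subset U^*\qquad\text{and}\qquad \mu^*\Bigl(U^*\setminus\bigcup_{n\in N^{(u)}}(\Omega_n^{(u)}\ominus n)\Bigr)=0.$$ -/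

import Mathlib

open MeasureTheory Set

/-- The additive subgroup of all two-sided sequences over `ℤ/p` that vanish far to the left. -/
def vilenkinSubgroup (p : ℕ) : AddSubgroup (ℤ → ZMod p) where
  carrier := {x | ∃ k : ℤ, ∀ j < k, x j = 0}
  zero_mem' := ⟨0, fun _ _ => rfl⟩
  add_mem' := by
    rintro x y ⟨k, hk⟩ ⟨l, hl⟩
    refine ⟨min k l, fun j hj => ?_⟩
    rw [Pi.add_apply, hk j (lt_of_lt_of_le hj (min_le_left _ _)),
      hl j (lt_of_lt_of_le hj (min_le_right _ _)), add_zero]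
  neg_mem' := by
    rintro x ⟨k, hk⟩
    refine ⟨k, fun j hj => ?_⟩
    rw [Pi.neg_apply, hk j hj, neg_zero]

/-- The Vilenkin group `G`: sequences `(x_j)`, `j ∈ ℤ`, with digits modulo `p`, vanishing far to the
left, with coordinatewise addition modulo `p`. Its topology is defined below; it is not
the subspace topology of the product. -/
def Vilenkin (p : ℕ) : Type := vilenkinSubgroup p

/-- The dual group `G*` consists of the same sequences, with the same group structure, topology and
dilations; a sequence `ω` stands for the character `chi · ω` below. -/
abbrev VilenkinDual (p : ℕ) : Type := Vilenkin p

namespace Vilenkin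

variable {p : ℕ}

instance : AddCommGroup (Vilenkin p) := inferInstanceAs (AddCommGroup (vilenkinSubgroup p))

instance : CoeFun (Vilenkin p) (fun _ => ℤ → ZMod p) := ⟨fun x => x.1⟩

@[ext] theorem ext {x y : Vilenkin p} (h : ∀ j, x j = y j) : x = y := Subtype.ext (funext h)

@[simp] theorem zero_apply (j : ℤ) : (0 : Vilenkin p) j = 0 := rfl

@[simp] theorem add_apply (x y : Vilenkin p) (j : ℤ) : (x + y) j = x j + y j := rfl

@[simp] theorem neg_apply (x : Vilenkin p) (j : ℤ) : (-x) j = -x j := rfl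

@[simp] theorem sub_apply (x y : Vilenkin p) (j : ℤ) : (x - y) j = x j - y j := rfl

/-- The integer powers `ρ^k` of the dilation `ρ`, which is the automorphism with
`(ρ x)_j = x_{j+1}`; thus `(ρ^k x)_j = x_{j+k}`. -/
def rhoPow (p : ℕ) (k : ℤ) : Vilenkin p ≃+ Vilenkin p where
  toFun x := ⟨fun j => x (j + k), by
    obtain ⟨l, hl⟩ := x.2
    exact ⟨l - k, fun j hj => hl _ (by lia)⟩⟩
  invFun x := ⟨fun j => x (j - k), by
    obtain ⟨l, hl⟩ := x.2
    exact ⟨l + k, fun j hj => hl _ (by lia)⟩⟩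
  left_inv x := by
    ext j
    change x (j - k + k) = x j
    rw [sub_add_cancel]
  right_inv x := by
    ext j
    change x (j + k - k) = x j
    rw [add_sub_cancel_right]
  map_add' _ _ := rfl

/-- The integer powers `σ^k` of the inverse `σ` of `ρ`; thus `(σ^k x)_j = x_{j-k}`. -/
def sigmaPow (p : ℕ) (k : ℤ) : Vilenkin p ≃+ Vilenkin p := (rhoPow p k).symm

@[simp] theorem rhoPow_apply (k : ℤ) (x : Vilenkin p) (j : ℤ) : (rhoPow p k x) j = x (j + k) := rfl

@[simp] theorem sigmaPow_apply (k : ℤ) (x : Vilenkin p) (j : ℤ) :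
    (sigmaPow p k x) j = x (j - k) := rfl

/-- The subgroup `U` of all sequences with `x_j = 0` for `j ≤ 0` (written `U*` inside `G*`). -/
def U (p : ℕ) : AddSubgroup (Vilenkin p) where
  carrier := {x | ∀ j ≤ 0, x j = 0}
  zero_mem' := fun _ _ => rfl
  add_mem' := fun {x y} hx hy j hj => by rw [add_apply, hx j hj, hy j hj, add_zero]
  neg_mem' := fun {x} hx j hj => by rw [neg_apply, hx j hj, neg_zero]

/-- The subgroup `Λ` of all sequences with `x_j = 0` for `j > 0`. -/
def Lam (p : ℕ) : AddSubgroup (Vilenkin p) where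
  carrier := {x | ∀ j > 0, x j = 0}
  zero_mem' := fun _ _ => rfl
  add_mem' := fun {x y} hx hy j hj => by rw [add_apply, hx j hj, hy j hj, add_zero]
  neg_mem' := fun {x} hx j hj => by rw [neg_apply, hx j hj, neg_zero]

/-- The translates `x + U_m`, `m ∈ ℤ`, of the sets `U_m = ρ^m(U)`. -/
def cyl (x : Vilenkin p) (m : ℤ) : Set (Vilenkin p) :=
  (fun y => x + y) '' (rhoPow p m '' (U p : Set (Vilenkin p)))

theorem mem_cyl {x y : Vilenkin p} {m : ℤ} : y ∈ cyl x m ↔ ∀ j ≤ -m, y j = x j := by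
  constructor
  · rintro ⟨_, ⟨u, hu, rfl⟩, rfl⟩ j hj
    rw [add_apply, rhoPow_apply, hu (j + m) (by lia), add_zero]
  · intro h
    refine ⟨y - x, ⟨rhoPow p (-m) (y - x), fun j hj => ?_, ?_⟩, add_sub_cancel x y⟩
    · rw [rhoPow_apply, sub_apply, h _ (by lia), sub_self]
    · ext j
      rw [rhoPow_apply, rhoPow_apply]
      rw [add_neg_cancel_right]

/-- The topology of the Vilenkin group, with base all the sets `x + U_m`. -/
instance : TopologicalSpace (Vilenkin p) :=
  TopologicalSpace.generateFrom {S | ∃ (x : Vilenkin p) (m : ℤ), S = cyl x m}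

theorem isOpen_cyl (x : Vilenkin p) (m : ℤ) : IsOpen (cyl x m) :=
  TopologicalSpace.isOpen_generateFrom_of_mem ⟨x, m, rfl⟩

instance : IsTopologicalAddGroup (Vilenkin p) where
  continuous_add := by
    refine continuous_generateFrom_iff.2 ?_
    rintro _ ⟨x, m, rfl⟩
    refine isOpen_iff_forall_mem_open.2 ?_
    rintro ⟨a, b⟩ hab
    refine ⟨cyl a m ×ˢ cyl b m, ?_, (isOpen_cyl a m).prod (isOpen_cyl b m),
      mem_cyl.2 fun _ _ => rfl, mem_cyl.2 fun _ _ => rfl⟩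
    rintro ⟨c, d⟩ ⟨hc, hd⟩
    refine mem_cyl (m := m).2 fun j hj => ?_
    rw [← mem_cyl.1 hab j hj]
    change c j + d j = a j + b j
    rw [mem_cyl.1 hc j hj, mem_cyl.1 hd j hj]
  continuous_neg := by
    refine continuous_generateFrom_iff.2 ?_
    rintro _ ⟨x, m, rfl⟩
    have : (Neg.neg ⁻¹' cyl x m : Set (Vilenkin p)) = cyl (-x) m := by
      ext y
      simp only [mem_preimage, mem_cyl, neg_apply, neg_eq_iff_eq_neg]
    rw [this]
    exact isOpen_cyl _ _

theorem coe_U_eq_cyl : (U p : Set (Vilenkin p)) = cyl 0 0 := by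
  ext y
  rw [mem_cyl]
  rfl

theorem isCompact_U [NeZero p] : IsCompact (U p : Set (Vilenkin p)) := by
  let f : (ℤ → ZMod p) → Vilenkin p := fun y => ⟨fun j => if j ≤ 0 then 0 else y j, 1,
    fun j hj => if_pos (by lia)⟩
  have hfa : ∀ y j, f y j = if j ≤ 0 then 0 else y j := fun _ _ => rfl
  have hf : Continuous f := by
    refine continuous_generateFrom_iff.2 ?_
    rintro _ ⟨x, m, rfl⟩
    refine isOpen_iff_forall_mem_open.2 fun y hy => ?_
    refine ⟨(Finset.Ioc 0 (-m) : Set ℤ).pi fun j => {y j}, fun z hz => ?_,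
      isOpen_set_pi (Finset.finite_toSet _) fun j _ => isOpen_discrete _, fun j _ => rfl⟩
    refine mem_cyl (m := m).2 fun j hj => ?_
    rw [← mem_cyl.1 hy j hj, hfa, hfa]
    split_ifs with h
    · rfl
    · exact hz j (Finset.mem_coe.2 (Finset.mem_Ioc.2 ⟨by lia, hj⟩))
  have : (U p : Set (Vilenkin p)) = range f := by
    ext x
    constructor
    · intro hx
      refine ⟨x, ext fun j => ?_⟩
      rw [hfa]
      split_ifs with h
      · exact (hx j h).symm
      · rfl
    · rintro ⟨y, rfl⟩ j hj
      rw [hfa, if_pos hj]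
  rw [this]
  exact isCompact_range hf

/-- `U` as a compact set with non-empty interior. -/
def UCompact (p : ℕ) [NeZero p] : TopologicalSpace.PositiveCompacts (Vilenkin p) where
  carrier := U p
  isCompact' := isCompact_U
  interior_nonempty' := by
    rw [coe_U_eq_cyl, (isOpen_cyl 0 0).interior_eq]
    exact ⟨0, mem_cyl.2 fun _ _ => rfl⟩

instance : MeasurableSpace (Vilenkin p) := borel _

instance : BorelSpace (Vilenkin p) := ⟨rfl⟩

/-- The Haar measure, normalized so that `U` has measure `1`. -/
noncomputable def mu (p : ℕ) [NeZero p] : Measure (Vilenkin p) := Measure.addHaarMeasure (UCompact p)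

/-- The pairing `χ(x, ω) = exp((2πi/p) ∑_j x_j ω_{1-j})`; only finitely many summands are non-zero,
and the exponential depends only on the sum modulo `p`. -/
noncomputable def chi [NeZero p] (x : Vilenkin p) (ω : VilenkinDual p) : ℂ :=
  ZMod.stdAddChar (∑ᶠ j : ℤ, x j * ω (1 - j))

/-- The inverse Fourier transform (for integrable `f`). -/
noncomputable def invFourier [NeZero p] (f : VilenkinDual p → ℂ) (x : Vilenkin p) : ℂ :=
  ∫ ω, f ω * chi x ω ∂(mu p)

/-- `f_{j,n}(x) = p^{j/2} f(ρ^j(x) - n)`. -/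
noncomputable def affine (f : Vilenkin p → ℂ) (j : ℤ) (n : Vilenkin p) (x : Vilenkin p) : ℂ :=
  (((p : ℝ) ^ ((j : ℝ) / 2) : ℝ) : ℂ) * f (rhoPow p j x - n)

/-- The index set `{1, …, p - 1}`. -/
abbrev Idx (p : ℕ) : Type := Finset.Icc 1 (p - 1)

/-- `Ω` is a (multi)wavelet set: the indicator of each `Ω u` is in `L¹ ∩ L²` (finite measure), and,
with `ψ u` its inverse Fourier transform, the family `(ψ u)_{j,n}` is an
orthonormal basis of `L²(G)`. -/
def IsWaveletSet [NeZero p] (Ω : Idx p → Set (VilenkinDual p)) : Prop :=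
  (∀ u, mu p (Ω u) < ⊤) ∧
  ∃ b : HilbertBasis (Idx p × ℤ × Lam p) ℂ (Lp ℂ 2 (mu p)),
    ∀ (u : Idx p) (j : ℤ) (n : Lam p),
      b (u, j, n) =ᵐ[mu p] affine (invFourier ((Ω u).indicator fun _ => 1)) j n

/-- `A` is `Λ`-translation congruent to `B` up to null sets: `A` is partitioned into measurable
pieces `A n`, `n ∈ N ⊆ Λ`, whose translates `A n - n` lie in `B`, overlap pairwise only in
null sets and cover `B` up to a null set. -/
def TranslationCongruent [NeZero p] (A B : Set (VilenkinDual p)) : Prop :=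
  ∃ (N : Set (VilenkinDual p)) (P : VilenkinDual p → Set (VilenkinDual p)),
    N ⊆ (Lam p : Set (VilenkinDual p)) ∧
    ((∀ n ∈ N, MeasurableSet (P n) ∧ (P n).Nonempty) ∧ N.PairwiseDisjoint P ∧
      (⋃ n ∈ N, P n) = A) ∧
    (∀ n₁ ∈ N, ∀ n₂ ∈ N, n₁ ≠ n₂ →
      mu p (((fun ω => ω - n₁) '' P n₁) ∩ ((fun ω => ω - n₂) '' P n₂)) = 0) ∧
    (⋃ n ∈ N, (fun ω => ω - n) '' P n) ⊆ B ∧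
    mu p (B \ ⋃ n ∈ N, (fun ω => ω - n) '' P n) = 0

end Vilenkin

/-!
The Fourier transform turns the affine system generated by the functions `(1_{Ω u})^∨` into the
system of *wave packets* `ω ↦ p^{-j/2} 1_{Ω u}(σ^j ω) χ(-n, σ^j ω)` (`packet`), which live on the
dilates `ρ^j(Ω u)`. So, by Plancherel's theorem, `Ω` is a wavelet set exactly if these packets form
an orthonormal basis of `L²(G*)` (`isWaveletSet_iff`).

The characters `χ(n, ·)`, `n ∈ Λ`, are invariant under translation by `Λ`. Hence they are
orthonormal on a set `D` exactly if the periodized indicator function of `D` has the Fourier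
coefficients of `1`, that is, exactly if `D` is a fundamental domain of `Λ` up to null sets
(`isAddFundamentalDomain_of_setIntegral_chi`, `setIntegral_chi_of_isAddFundamentalDomain`), and
they are then also complete in `L²(D)` (`ae_eq_zero_of_setIntegral_mul_chi_eq_zero`). As `U` is a
fundamental domain of `Λ`, being one is the same as being `Λ`-translation congruent to `U`
(`translationCongruent_U_iff`).

If the `Ω u` are fundamental domains, then the packets of each fixed `u` and `j` form an orthonormal
basis of `L²(ρ^j(Ω u))`, so that together they form one of `L²(G*)` if these sets tile `G*`
(`exists_hilbertBasis_packet`). Conversely, let the packets form an orthonormal basis. Those with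
`j = 0` make each `Ω u` a fundamental domain; completeness on `ρ^j(Ω u)` together with orthogonality
to any packet carried by another `ρ^k(Ω v)` makes the two sets disjoint; and an indicator function
supported off all of them would be orthogonal to the whole basis.

Everything rests on one uniqueness statement, `setIntegral_eq_zero_of_lam_invariant`: an integrable
function whose integrals against all `χ(n, ·)`, `n ∈ Λ`, vanish has integral zero over every
`Λ`-invariant measurable set. Invariant sets are used in place of periodizations throughout.
Plancherel's theorem (`exists_linearIsometryEquiv_invFourier`) follows as well: the
packets at scale `0` on the cosets `l + U`, `l ∈ Λ`, are an orthonormal basis, and the Fourier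
transform merely permutes them.
-/

namespace Vilenkin

variable {p : ℕ}

/-! ### Integer and fractional parts, countability -/

/-- The fractional part of a sequence: its digits at the places `j ≥ 1`. -/
def frac (x : Vilenkin p) : Vilenkin p := ⟨fun j => if j ≤ 0 then 0 else x j, 1,
  fun j hj => if_pos (by lia)⟩

theorem frac_apply (x : Vilenkin p) (j : ℤ) : frac x j = if j ≤ 0 then 0 else x j := rfl

theorem frac_mem_U (x : Vilenkin p) : frac x ∈ U p := fun _ hj => if_pos hj

theorem sub_sub_frac_mem_U (x : Vilenkin p) : x - (x - frac x) ∈ U p := by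
  rw [sub_sub_cancel]
  exact frac_mem_U x

theorem sub_frac_mem_Lam (x : Vilenkin p) : x - frac x ∈ Lam p := fun j hj => by
  rw [sub_apply, frac_apply, if_neg (by lia), sub_self]

theorem eq_zero_of_mem_U_of_mem_Lam {x : Vilenkin p} (hU : x ∈ U p) (hL : x ∈ Lam p) : x = 0 := by
  ext j
  rcases le_or_gt j 0 with h | h
  · exact hU j h
  · exact hL j h

theorem frac_eq_self {x : Vilenkin p} (hx : x ∈ U p) : frac x = x := by
  ext j
  rw [frac_apply]
  split_ifs with h
  · exact (hx j h).symm
  · rfl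

/-- Membership in a translate of `U` determines the `Λ`-part. -/
theorem eq_of_sub_mem_U {x l m : Vilenkin p} (hl : l ∈ Lam p) (hm : m ∈ Lam p)
    (h₁ : x - l ∈ U p) (h₂ : x - m ∈ U p) : l = m := by
  have h : m - l ∈ U p := by simpa using sub_mem h₁ h₂
  exact (sub_eq_zero.1 (eq_zero_of_mem_U_of_mem_Lam h (sub_mem hm hl))).symm

/-- The sequence whose only non-zero digit is `c`, at the place `k`. -/
def single (k : ℤ) (c : ZMod p) : Vilenkin p := ⟨fun j => if j = k then c else 0, k,
  fun j hj => if_neg (by lia)⟩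

theorem single_apply (k : ℤ) (c : ZMod p) (j : ℤ) : single k c j = if j = k then c else 0 := rfl

instance : Countable (Lam p) := by
  have hfin : ∀ l : Lam p, (Function.support (l.1 : ℤ → ZMod p)).Finite := by
    rintro ⟨l, hl⟩
    obtain ⟨k, hk⟩ := l.2
    refine (Set.finite_Icc k 0).subset fun j hj => ⟨?_, ?_⟩
    · by_contra h
      exact hj (hk j (by lia))
    · by_contra h
      exact hj (hl j (by lia))
  have hc : Countable (ZMod p) := by
    cases p with
    | zero => exact inferInstanceAs (Countable ℤ)
    | succ n => exact inferInstanceAs (Countable (Fin (n + 1)))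
  refine Function.Injective.countable (f := fun l => Finsupp.ofSupportFinite _ (hfin l)) ?_
  intro l m h
  exact Subtype.ext (ext fun j => DFunLike.congr_fun h j)

theorem countable_cyl : {S : Set (Vilenkin p) | ∃ x m, S = cyl x m}.Countable := by
  refine (countable_range fun q : Lam p × ℤ => cyl (rhoPow p q.2 q.1) q.2).mono ?_
  rintro _ ⟨x, m, rfl⟩
  refine ⟨(⟨rhoPow p (-m) x - frac (rhoPow p (-m) x), sub_frac_mem_Lam _⟩, m), ?_⟩
  ext y
  refine mem_cyl.trans (Iff.trans ?_ mem_cyl.symm)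
  refine forall₂_congr fun j hj => ?_
  simp only [rhoPow_apply, sub_apply, frac_apply]
  rw [if_pos (by lia), sub_zero, add_neg_cancel_right]

instance : SecondCountableTopology (Vilenkin p) := ⟨⟨_, countable_cyl, rfl⟩⟩

theorem measurableSpace_eq_generateFrom :
    (inferInstance : MeasurableSpace (Vilenkin p)) =
      MeasurableSpace.generateFrom {S | ∃ (x : Vilenkin p) (m : ℤ), S = cyl x m} :=
  borel_eq_generateFrom_of_subbasis rfl

theorem cyl_eq_of_mem {x y : Vilenkin p} {m : ℤ} (h : y ∈ cyl x m) : cyl x m = cyl y m := by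
  ext z
  exact mem_cyl.trans (Iff.trans (forall₂_congr fun j hj => by rw [mem_cyl.1 h j hj]) mem_cyl.symm)

theorem isPiSystem_cyl : IsPiSystem {S | ∃ (x : Vilenkin p) (m : ℤ), S = cyl x m} := by
  rintro _ ⟨x, m, rfl⟩ _ ⟨y, k, rfl⟩ ⟨z, hz, hz'⟩
  refine ⟨z, min m k, ?_⟩
  rw [cyl_eq_of_mem hz, cyl_eq_of_mem hz']
  ext w
  simp only [mem_inter_iff, mem_cyl]
  refine ⟨fun h j hj => ?_, fun h => ⟨fun j hj => h j (by lia), fun j hj => h j (by lia)⟩⟩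
  rcases le_total m k with hmk | hmk
  · exact h.1 j (by rwa [min_eq_left hmk] at hj)
  · exact h.2 j (by rwa [min_eq_right hmk] at hj)

theorem continuous_rhoPow (k : ℤ) : Continuous (rhoPow p k) := by
  refine continuous_generateFrom_iff.2 ?_
  rintro _ ⟨x, m, rfl⟩
  have : rhoPow p k ⁻¹' cyl x m = cyl (rhoPow p (-k) x) (m - k) := by
    ext y
    simp only [mem_preimage, mem_cyl, rhoPow_apply]
    refine ⟨fun h j hj => ?_, fun h j hj => ?_⟩
    · simpa [sub_eq_add_neg] using h (j - k) (by lia)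
    · simpa using h (j + k) (by lia)
  rw [this]
  exact isOpen_cyl _ _

theorem sigmaPow_eq_rhoPow (k : ℤ) (x : Vilenkin p) : sigmaPow p k x = rhoPow p (-k) x := by
  ext j
  rw [sigmaPow_apply, rhoPow_apply, sub_eq_add_neg]

theorem continuous_sigmaPow (k : ℤ) : Continuous (sigmaPow p k) := by
  rw [show ⇑(sigmaPow p k) = rhoPow p (-k) from funext (sigmaPow_eq_rhoPow k)]
  exact continuous_rhoPow _

theorem sigmaPow_rhoPow (k : ℤ) (x : Vilenkin p) : sigmaPow p k (rhoPow p k x) = x :=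
  (rhoPow p k).symm_apply_apply x

theorem rhoPow_sigmaPow (k : ℤ) (x : Vilenkin p) : rhoPow p k (sigmaPow p k x) = x :=
  (rhoPow p k).apply_symm_apply x

theorem measurable_frac : Measurable (frac : Vilenkin p → Vilenkin p) := by
  refine Continuous.measurable (continuous_generateFrom_iff.2 ?_)
  rintro _ ⟨x, m, rfl⟩
  refine isOpen_iff_forall_mem_open.2 fun y hy => ⟨cyl y m, fun z hz => ?_, isOpen_cyl _ _,
    mem_cyl.2 fun _ _ => rfl⟩
  refine mem_cyl.2 fun j hj => ?_
  rw [← mem_cyl.1 hy j hj, frac_apply, frac_apply, mem_cyl.1 hz j hj]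

theorem measurableSet_U : MeasurableSet (U p : Set (Vilenkin p)) := by
  rw [coe_U_eq_cyl]
  exact (isOpen_cyl _ _).measurableSet

/-! ### Haar measure and the dilations -/

variable [NeZero p]

instance : (mu p).IsAddHaarMeasure := inferInstanceAs (Measure.addHaarMeasure _).IsAddHaarMeasure

instance : SigmaFinite (mu p) := inferInstanceAs (SigmaFinite (Measure.addHaarMeasure _))

instance : VAddInvariantMeasure (Lam p) (Vilenkin p) (mu p) :=
  ⟨fun c _ _ => measure_preimage_add (mu p) (c : Vilenkin p) _⟩

theorem mu_U : mu p (U p) = 1 := Measure.addHaarMeasure_self (K₀ := UCompact p)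

theorem mu_cyl_eq (x : Vilenkin p) (m : ℤ) : mu p (cyl x m) = mu p (cyl 0 m) := by
  rw [← measure_preimage_add (mu p) x (cyl x m)]
  congr 1
  ext y
  simp [mem_cyl]

theorem mu_cyl_succ (m : ℤ) : mu p (cyl 0 (m + 1)) = p * mu p (cyl 0 m) := by
  have h : cyl (0 : Vilenkin p) (m + 1) = ⋃ c : ZMod p, cyl (single (-m) c) m := by
    ext x
    simp only [mem_iUnion, mem_cyl, zero_apply, single_apply]
    refine ⟨fun hx => ⟨x (-m), fun j hj => ?_⟩, ?_⟩
    · split_ifs with h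
      · rw [h]
      · exact hx j (by lia)
    · rintro ⟨c, hc⟩ j hj
      rw [hc j (by lia), if_neg (by lia)]
  rw [h, measure_iUnion]
  · simp_rw [mu_cyl_eq (single _ _)]
    rw [tsum_fintype, Finset.sum_const, Finset.card_univ, ZMod.card, nsmul_eq_mul]
  · intro c d hcd
    refine Set.disjoint_left.2 fun x hx hx' => hcd ?_
    have h1 := mem_cyl.1 hx (-m) le_rfl
    have h2 := mem_cyl.1 hx' (-m) le_rfl
    rw [single_apply, if_pos rfl] at h1 h2
    rw [← h1, ← h2]
  · exact fun c => (isOpen_cyl _ _).measurableSet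

theorem mu_cyl (x : Vilenkin p) (m : ℤ) : mu p (cyl x m) = ENNReal.ofReal ((p : ℝ) ^ m) := by
  have hp : (p : ℝ) ≠ 0 := NeZero.ne _
  have hp' : (p : ENNReal) ≠ 0 := NeZero.ne _
  rw [mu_cyl_eq]
  induction m using Int.induction_on with
  | zero => rw [← coe_U_eq_cyl, mu_U]; simp
  | succ i ih =>
    rw [mu_cyl_succ, ih, zpow_add_one₀ hp, mul_comm, ENNReal.ofReal_mul (by positivity),
      ENNReal.ofReal_natCast]
  | pred i ih =>
    have h := mu_cyl_succ (p := p) (-(i : ℤ) - 1)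
    rw [sub_add_cancel, ih] at h
    have e : (p : ℝ) ^ (-(i : ℤ)) = p * (p : ℝ) ^ (-(i : ℤ) - 1) := by
      rw [zpow_sub_one₀ hp]; field_simp
    rw [e, ENNReal.ofReal_mul (by positivity), ENNReal.ofReal_natCast] at h
    exact ((ENNReal.mul_right_inj hp' (ENNReal.natCast_ne_top p)).1 h).symm

/-- The dilation `ρ^k` as a measurable automorphism. -/
def rhoEquiv (p : ℕ) (k : ℤ) : Vilenkin p ≃ᵐ Vilenkin p where
  toEquiv := (rhoPow p k).toEquiv
  measurable_toFun := (continuous_rhoPow k).measurable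
  measurable_invFun := (continuous_sigmaPow k).measurable

theorem map_rhoPow (k : ℤ) :
    (mu p).map (rhoPow p k) = ENNReal.ofReal ((p : ℝ) ^ (-k)) • mu p := by
  have hinv : ((mu p).map (rhoPow p k)).IsAddHaarMeasure :=
    (rhoPow p k).isAddHaarMeasure_map (mu p) (continuous_rhoPow k) (continuous_sigmaPow k)
  have hs : SigmaFinite ((mu p).map (rhoPow p k)) := (rhoEquiv p k).sigmaFinite_map
  rw [Measure.addHaarMeasure_unique ((mu p).map (rhoPow p k)) (UCompact p)]
  congr 1
  change (mu p).map (rhoPow p k) (U p : Set (Vilenkin p)) = _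
  rw [Measure.map_apply (continuous_rhoPow k).measurable measurableSet_U, ← mu_cyl 0 (-k)]
  congr 1
  ext y
  rw [mem_cyl]
  refine ⟨fun h j hj => ?_, fun h j hj => ?_⟩
  · simpa using h (j - k) (by lia)
  · exact h (j + k) (by lia)

theorem integral_comp_rhoPow (k : ℤ) (f : Vilenkin p → ℂ) :
    ∫ x, f (rhoPow p k x) ∂mu p = ((p : ℝ) ^ (-k) : ℝ) * ∫ x, f x ∂mu p := by
  have h := integral_map_equiv (μ := mu p) (rhoEquiv p k) f
  change ∫ y, f y ∂(mu p).map (rhoPow p k) = ∫ x, f (rhoPow p k x) ∂mu p at h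
  rw [← h, map_rhoPow, integral_smul_measure, ENNReal.toReal_ofReal (by positivity),
    Complex.real_smul]

theorem integral_comp_sigmaPow (k : ℤ) (f : Vilenkin p → ℂ) :
    ∫ x, f (sigmaPow p k x) ∂mu p = ((p : ℝ) ^ k : ℝ) * ∫ x, f x ∂mu p := by
  simp_rw [sigmaPow_eq_rhoPow, integral_comp_rhoPow, neg_neg]

theorem quasiMeasurePreserving_rhoPow (k : ℤ) :
    Measure.QuasiMeasurePreserving (rhoPow p k) (mu p) (mu p) :=
  ⟨(continuous_rhoPow k).measurable, by rw [map_rhoPow]; exact Measure.smul_absolutelyContinuous⟩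

theorem quasiMeasurePreserving_sigmaPow (k : ℤ) :
    Measure.QuasiMeasurePreserving (sigmaPow p k) (mu p) (mu p) := by
  rw [show ⇑(sigmaPow p k) = rhoPow p (-k) from funext (sigmaPow_eq_rhoPow k)]
  exact quasiMeasurePreserving_rhoPow _

theorem integrable_comp_rhoPow {f : Vilenkin p → ℂ} (hf : Integrable f (mu p)) (k : ℤ) :
    Integrable (fun x => f (rhoPow p k x)) (mu p) := by
  have h : Integrable f ((mu p).map (rhoPow p k)) := by
    rw [map_rhoPow]
    exact hf.smul_measure ENNReal.ofReal_ne_top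
  exact h.comp_measurable (continuous_rhoPow k).measurable

theorem integrable_comp_sigmaPow {f : Vilenkin p → ℂ} (hf : Integrable f (mu p)) (k : ℤ) :
    Integrable (fun x => f (sigmaPow p k x)) (mu p) := by
  simp_rw [sigmaPow_eq_rhoPow]
  exact integrable_comp_rhoPow hf _

/-! ### The pairing -/

omit [NeZero p] in
theorem hasFiniteSupport_pairing (x ω : Vilenkin p) :
    (fun j : ℤ => x j * ω (1 - j)).HasFiniteSupport := by
  obtain ⟨k, hk⟩ := x.2
  obtain ⟨l, hl⟩ := ω.2
  refine (Set.finite_Icc k (1 - l)).subset fun j hj => ⟨?_, ?_⟩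
  · by_contra h
    exact hj (by simp only [hk j (by lia), zero_mul])
  · by_contra h
    exact hj (by simp only [hl (1 - j) (by lia), mul_zero])

theorem chi_add_left (x y ω : Vilenkin p) : chi (x + y) ω = chi x ω * chi y ω := by
  unfold chi
  rw [← AddChar.map_add_eq_mul, ← finsum_add_distrib (hasFiniteSupport_pairing x ω)
    (hasFiniteSupport_pairing y ω)]
  simp only [add_apply, add_mul]

theorem chi_comm (x ω : Vilenkin p) : chi x ω = chi ω x := by
  unfold chi
  congr 1
  rw [← finsum_comp_equiv (Equiv.subLeft (1 : ℤ))]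
  refine finsum_congr fun j => ?_
  rw [Equiv.subLeft_apply, sub_sub_cancel, mul_comm]

theorem chi_add_right (x ω η : Vilenkin p) : chi x (ω + η) = chi x ω * chi x η := by
  rw [chi_comm, chi_add_left, chi_comm ω, chi_comm η]

@[simp] theorem chi_zero_left (ω : Vilenkin p) : chi 0 ω = 1 := by
  simp [chi]

@[simp] theorem norm_chi (x ω : Vilenkin p) : ‖chi x ω‖ = 1 := AddChar.norm_apply _ _

theorem chi_neg_left (x ω : Vilenkin p) : chi (-x) ω = starRingEnd ℂ (chi x ω) := by
  unfold chi
  rw [← AddChar.map_neg_eq_conj, ← finsum_neg_distrib]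
  simp only [neg_apply, neg_mul]

theorem chi_rhoPow (k : ℤ) (x ω : Vilenkin p) : chi (rhoPow p k x) ω = chi x (rhoPow p k ω) := by
  unfold chi
  congr 1
  rw [← finsum_comp_equiv (Equiv.subRight k)]
  refine finsum_congr fun j => ?_
  simp only [Equiv.subRight_apply, rhoPow_apply, sub_add_cancel]
  rw [show (1 : ℤ) - (j - k) = 1 - j + k by ring]

theorem chi_eq_one {x ω : Vilenkin p} (h : ∀ j, x j = 0 ∨ ω (1 - j) = 0) : chi x ω = 1 := by
  unfold chi
  rw [finsum_eq_zero_of_forall_eq_zero, AddChar.map_zero_eq_one]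
  intro j
  rcases h j with h | h <;> simp [h]

theorem chi_eq_one_of_mem_U {x ω : Vilenkin p} (hx : x ∈ U p) (hω : ω ∈ U p) : chi x ω = 1 :=
  chi_eq_one fun j => (le_or_gt j 0).imp (hx j) fun h => hω _ (by lia)

theorem chi_eq_one_of_mem_Lam {x ω : Vilenkin p} (hx : x ∈ Lam p) (hω : ω ∈ Lam p) :
    chi x ω = 1 :=
  chi_eq_one fun j => (lt_or_ge 0 j).imp (hx j) fun h => hω _ (by lia)

theorem chi_single (k : ℤ) (c : ZMod p) (ω : Vilenkin p) :
    chi (single k c) ω = ZMod.stdAddChar (c * ω (1 - k)) := by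
  unfold chi
  congr 1
  rw [finsum_eq_single _ k fun j hj => by rw [single_apply, if_neg hj, zero_mul], single_apply,
    if_pos rfl]

theorem chi_lam_add {n l : Vilenkin p} (hn : n ∈ Lam p) (hl : l ∈ Lam p) (ω : Vilenkin p) :
    chi n (l + ω) = chi n ω := by
  rw [chi_add_right, chi_eq_one_of_mem_Lam hn hl, one_mul]

theorem continuous_chi : Continuous fun q : Vilenkin p × Vilenkin p => chi q.1 q.2 := by
  refine continuous_iff_continuousAt.2 fun ⟨x, ω⟩ => ?_
  obtain ⟨k, hk⟩ := x.2
  obtain ⟨l, hl⟩ := ω.2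
  -- The pairing is locally constant: near `(x, ω)` only the digits with `k ≤ j ≤ 1 - l` count.
  have h : (fun _ => chi x ω) =ᶠ[nhds (x, ω)] fun q : Vilenkin p × Vilenkin p => chi q.1 q.2 := by
    have h₁ : cyl x (-(max k (1 - l))) ∈ nhds x :=
      (isOpen_cyl _ _).mem_nhds (mem_cyl.2 fun _ _ => rfl)
    have h₂ : cyl ω (-(max l (1 - k))) ∈ nhds ω :=
      (isOpen_cyl _ _).mem_nhds (mem_cyl.2 fun _ _ => rfl)
    filter_upwards [prod_mem_nhds h₁ h₂] with q hq
    have hx := mem_cyl.1 hq.1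
    have hω := mem_cyl.1 hq.2
    unfold chi
    congr 1
    refine finsum_congr fun j => ?_
    rcases lt_or_ge j k with hj | hj
    · rw [hx j (by lia), hk j hj, zero_mul, zero_mul]
    rcases lt_or_ge (1 - j) l with hj' | hj'
    · rw [hω (1 - j) (by lia), hl (1 - j) hj', mul_zero, mul_zero]
    rw [hx j (by lia), hω (1 - j) (by lia)]
  exact continuousAt_const.congr h

theorem continuous_chi_right (x : Vilenkin p) : Continuous fun ω => chi x ω := by
  have h : Continuous fun ω : Vilenkin p => (x, ω) := by fun_prop
  have h' := continuous_chi.comp h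
  simp only [Function.comp_def] at h'
  exact h'

theorem integrable_mul_chi {f : Vilenkin p → ℂ} (hf : Integrable f (mu p)) (x : Vilenkin p) :
    Integrable (fun ω => f ω * chi x ω) (mu p) :=
  hf.mul_bdd (c := 1) (continuous_chi_right x).aestronglyMeasurable
    (Filter.Eventually.of_forall fun ω => (norm_chi x ω).le)

theorem setIntegral_U_chi (x : Vilenkin p) [Decidable (x ∈ U p)] :
    ∫ ω in (U p : Set (Vilenkin p)), chi x ω ∂mu p = if x ∈ U p then 1 else 0 := by
  split_ifs with hx
  · rw [setIntegral_congr_fun measurableSet_U fun ω hω => chi_eq_one_of_mem_U hx hω]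
    simp [Measure.real, mu_U]
    -- A character that is non-trivial on `U` has integral zero, by translation invariance.
  · obtain ⟨j, hj, hxj⟩ : ∃ j ≤ 0, x j ≠ 0 := by
      by_contra! h
      exact hx h
    have hη : single (1 - j) 1 ∈ U p := fun i hi => by rw [single_apply, if_neg (by lia)]
    have hne : chi x (single (1 - j) 1) ≠ 1 := by
      rw [chi_comm, chi_single, one_mul, sub_sub_cancel]
      rw [← AddChar.map_zero_eq_one (ZMod.stdAddChar (N := p))]
      exact fun h => hxj (ZMod.injective_stdAddChar h)
    rw [← integral_indicator measurableSet_U]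
    have h := integral_add_left_eq_self (μ := mu p)
      ((U p : Set (Vilenkin p)).indicator fun ω => chi x ω) (single (1 - j) 1)
    have h' : ∀ ω, (U p : Set (Vilenkin p)).indicator (fun ω => chi x ω) (single (1 - j) 1 + ω) =
        chi x (single (1 - j) 1) * (U p : Set (Vilenkin p)).indicator (fun ω => chi x ω) ω := by
      intro ω
      by_cases hω : ω ∈ U p
      · have hω' : single (1 - j) 1 + ω ∈ (U p : Set (Vilenkin p)) := add_mem hη hω
        rw [indicator_of_mem hω', indicator_of_mem (SetLike.mem_coe.2 hω), chi_add_right]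
      · have hω' : single (1 - j) 1 + ω ∉ (U p : Set (Vilenkin p)) :=
          fun h => hω ((add_mem_cancel_left hη).1 h)
        rw [indicator_of_notMem hω', indicator_of_notMem (mt SetLike.mem_coe.1 hω), mul_zero]
    simp_rw [h', integral_const_mul] at h
    by_contra h0
    exact hne (mul_right_cancel₀ h0 (h.trans (one_mul _).symm))

/-! ### Fourier uniqueness on `Λ`-invariant sets -/

/-- The `Λ`-invariant set of all `ω` whose digits at the places `1, …, M` are those of `a`. -/
def digitSet (a : Vilenkin p) (M : ℕ) : Set (Vilenkin p) := {ω | ∀ j : ℤ, 1 ≤ j → j ≤ M → ω j = a j}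

omit [NeZero p] in
theorem digitSet_zero (a : Vilenkin p) : digitSet a 0 = univ := by
  refine eq_univ_of_forall fun ω j h1 h2 => ?_
  simp only [Nat.cast_zero] at h2
  lia

omit [NeZero p] in
theorem frac_preimage_cyl (a : Vilenkin p) (m : ℤ) :
    frac ⁻¹' cyl a m = ∅ ∨ frac ⁻¹' cyl a m = digitSet a (-m).toNat := by
  by_cases h : ∀ j ≤ min 0 (-m), a j = 0
  · right
    ext ω
    simp only [mem_preimage, mem_cyl, digitSet, mem_ofPred_eq, frac_apply]
    refine ⟨fun hω j h1 h2 => ?_, fun hω j hj => ?_⟩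
    · rw [← hω j (by lia), if_neg (by lia)]
    · split_ifs with h0
      · exact (h j (by lia)).symm
      · exact hω j (by lia) (by lia)
  · left
    push Not at h
    obtain ⟨j, hj, hne⟩ := h
    refine eq_empty_of_forall_notMem fun ω hω => hne ?_
    rw [← mem_cyl.1 hω j (by lia), frac_apply, if_pos (by lia)]

omit [NeZero p] in
theorem measurableSet_digitSet (a : Vilenkin p) (M : ℕ) : MeasurableSet (digitSet a M) := by
  have h : digitSet (frac a) M = frac ⁻¹' cyl (frac a) (-M) := by
    rcases frac_preimage_cyl (frac a) (-M : ℤ) with h | h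
    · exact absurd (show frac a ∈ frac ⁻¹' cyl (frac a) (-M : ℤ) from mem_cyl.2 fun j _ => by
        rw [frac_eq_self (frac_mem_U a)]) (by rw [h]; exact notMem_empty _)
    · rw [h, neg_neg, Int.toNat_natCast]
  have h' : digitSet (frac a) M = digitSet a M := by
    ext ω
    refine forall₃_congr fun j h1 h2 => ?_
    rw [frac_apply, if_neg (by lia)]
  rw [← h', h]
  exact measurable_frac (isOpen_cyl _ _).measurableSet

/-- Fixing one more digit amounts to averaging over the `p` characters that see only that digit. -/
theorem digitSet_succ_indicator (a ω : Vilenkin p) (M : ℕ) :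
    (digitSet a (M + 1)).indicator (fun _ => (1 : ℂ)) ω =
      (p : ℂ)⁻¹ * ∑ c : ZMod p, (digitSet a M).indicator (fun _ => (1 : ℂ)) ω *
        (chi (single (-M) c) ω * ZMod.stdAddChar (-(c * a (M + 1)))) := by
  have hp : (p : ℂ) ≠ 0 := NeZero.ne _
  have hsum : ∑ c : ZMod p, (chi (single (-M) c) ω * ZMod.stdAddChar (-(c * a (M + 1)))) =
      if ω (M + 1) = a (M + 1) then (p : ℂ) else 0 := by
    have h := AddChar.sum_mulShift (ω (M + 1) - a (M + 1)) (ZMod.isPrimitive_stdAddChar p)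
    simp only [sub_eq_zero, ZMod.card] at h
    rw [apply_ite (Nat.cast : ℕ → ℂ), Nat.cast_zero] at h
    rw [← h]
    refine Finset.sum_congr rfl fun c _ => ?_
    rw [chi_single, ← AddChar.map_add_eq_mul]
    congr 1
    rw [show (1 : ℤ) - -M = M + 1 by ring]
    ring
  rw [← Finset.mul_sum, hsum]
  have hiff : ω ∈ digitSet a (M + 1) ↔ ω ∈ digitSet a M ∧ ω (M + 1) = a (M + 1) := by
    simp only [digitSet, mem_ofPred_eq]
    push_cast
    refine ⟨fun h => ⟨fun j h1 h2 => h j h1 (by lia), h _ (by lia) le_rfl⟩, fun h j h1 h2 => ?_⟩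
    rcases eq_or_ne j (M + 1) with rfl | hne
    · exact h.2
    · exact h.1 j h1 (by lia)
  by_cases h1 : ω ∈ digitSet a M <;> by_cases h2 : ω (M + 1) = a (M + 1) <;>
    simp [indicator, hiff, h1, h2, hp]

theorem setIntegral_digitSet_mul_chi {h : Vilenkin p → ℂ} (hi : Integrable h (mu p))
    (h0 : ∀ n ∈ Lam p, ∫ ω, h ω * chi n ω ∂mu p = 0) (a : Vilenkin p) (M : ℕ) :
    ∀ n ∈ Lam p, ∫ ω in digitSet a M, h ω * chi n ω ∂mu p = 0 := by
  induction M with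
  | zero => simpa only [digitSet_zero, setIntegral_univ] using h0
  | succ M ih =>
    intro n hn
    have hs : ∀ c, single (-M : ℤ) c ∈ Lam p := fun c j hj => by
      rw [single_apply, if_neg (by lia)]
    rw [← integral_indicator (measurableSet_digitSet _ _)]
    have e : ∀ ω, (digitSet a (M + 1)).indicator (fun ω => h ω * chi n ω) ω =
        (p : ℂ)⁻¹ * ∑ c : ZMod p, ZMod.stdAddChar (-(c * a (M + 1))) *
          (digitSet a M).indicator (fun ω => h ω * chi (n + single (-M) c) ω) ω := by
      intro ω
      have := digitSet_succ_indicator a ω M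
      calc _ = (h ω * chi n ω) * (digitSet a (M + 1)).indicator (fun _ => (1 : ℂ)) ω := by
            by_cases hω : ω ∈ digitSet a (M + 1) <;> simp [hω]
        _ = _ := by
            rw [this, mul_left_comm, Finset.mul_sum]
            congr 1
            refine Finset.sum_congr rfl fun c _ => ?_
            by_cases hω : ω ∈ digitSet a M
            · simp only [indicator_of_mem hω]
              rw [chi_add_left]
              ring
            · simp only [indicator_of_notMem hω]; ring
    simp_rw [e]
    rw [integral_const_mul, integral_finsetSum]
    · simp_rw [integral_const_mul, integral_indicator (measurableSet_digitSet a M)]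
      rw [Finset.sum_eq_zero, mul_zero]
      intro c _
      rw [ih _ (add_mem hn (hs c)), mul_zero]
    · exact fun c _ =>
        ((integrable_mul_chi hi _).indicator (measurableSet_digitSet a M)).const_mul _

/-- If all the `Λ`-Fourier coefficients of an integrable function vanish, then so do
its integrals over the `Λ`-invariant measurable sets: its periodization is zero. -/
theorem setIntegral_eq_zero_of_lam_invariant {h : Vilenkin p → ℂ} (hi : Integrable h (mu p))
    (h0 : ∀ n ∈ Lam p, ∫ ω, h ω * chi n ω ∂mu p = 0) {B : Set (Vilenkin p)}
    (hB : MeasurableSet B) (hinv : ∀ l ∈ Lam p, ∀ x, l + x ∈ B ↔ x ∈ B) :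
    ∫ ω in B, h ω ∂mu p = 0 := by
  have hBf : B = frac ⁻¹' B := by
    ext x
    rw [mem_preimage, ← hinv _ (sub_frac_mem_Lam x) (frac x), sub_add_cancel]
  have htot : ∫ ω, h ω ∂mu p = 0 := by simpa using h0 0 (zero_mem _)
  rw [hBf]
  clear hBf hinv
  induction B, hB using MeasurableSpace.induction_on_inter measurableSpace_eq_generateFrom
    isPiSystem_cyl with
  | empty => simp
  | basic t ht =>
    obtain ⟨a, m, rfl⟩ := ht
    rcases frac_preimage_cyl a m with h | h
    · rw [h]; simp
    · rw [h]
      simpa using setIntegral_digitSet_mul_chi hi h0 a (-m).toNat 0 (zero_mem _)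
  | compl t ht ih =>
    rw [preimage_compl, setIntegral_compl (measurable_frac ht) hi, ih, htot, sub_zero]
  | iUnion f hd hf ih =>
    rw [preimage_iUnion]
    have := hasSum_integral_iUnion (μ := mu p) (f := h) (s := fun i => frac ⁻¹' f i)
      (fun i => measurable_frac (hf i)) (fun i j hij => (hd hij).preimage _) hi.integrableOn
    simp_rw [ih] at this
    exact this.unique hasSum_zero

/-! ### Fundamental domains of `Λ` -/

open scoped Pointwise

/-- The translate `l + U`. -/
def coset (l : Vilenkin p) : Set (Vilenkin p) := {x | x - l ∈ U p}

omit [NeZero p] in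
theorem measurableSet_coset (l : Vilenkin p) : MeasurableSet (coset l) :=
  (measurable_sub_const l) measurableSet_U

omit [NeZero p] in
theorem lam_vadd_mem {D : Set (Vilenkin p)} {l : Lam p} {x : Vilenkin p} :
    x ∈ l +ᵥ D ↔ x - l ∈ D := by
  rw [mem_vadd_set_iff_neg_vadd_mem]
  change -(l : Vilenkin p) + x ∈ D ↔ _
  rw [neg_add_eq_sub]

theorem isAddFundamentalDomain_coset {l : Vilenkin p} (hl : l ∈ Lam p) :
    IsAddFundamentalDomain (Lam p) (coset l) (mu p) where
  nullMeasurableSet := (measurableSet_coset l).nullMeasurableSet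
  ae_covers := Filter.Eventually.of_forall fun x => by
    refine ⟨⟨l - (x - frac x), sub_mem hl (sub_frac_mem_Lam x)⟩, ?_⟩
    change l - (x - frac x) + x - l ∈ U p
    rw [show l - (x - frac x) + x - l = frac x by abel]
    exact frac_mem_U x
  aedisjoint := by
    intro a b hab
    refine (Set.disjoint_left.2 fun x ha hb => hab ?_).aedisjoint
    rw [lam_vadd_mem] at ha hb
    have ha' : x - (a + l) ∈ U p := by rw [← sub_sub]; exact ha
    have hb' : x - (b + l) ∈ U p := by rw [← sub_sub]; exact hb
    exact Subtype.ext (add_right_cancel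
      (eq_of_sub_mem_U (add_mem a.2 hl) (add_mem b.2 hl) ha' hb'))

omit [NeZero p] in
theorem coset_zero : coset (0 : Vilenkin p) = U p := by
  ext x
  change x - 0 ∈ U p ↔ x ∈ U p
  rw [sub_zero]

theorem isAddFundamentalDomain_U : IsAddFundamentalDomain (Lam p) (U p : Set (Vilenkin p)) (mu p) :=
  coset_zero (p := p) ▸ isAddFundamentalDomain_coset (zero_mem _)

/-- The smallest `Λ`-invariant set that contains `S`. -/
def saturation (S : Set (Vilenkin p)) : Set (Vilenkin p) :=
  ⋃ l : Lam p, {x : Vilenkin p | x - (l : Vilenkin p) ∈ S}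

omit [NeZero p] in
theorem mem_saturation {S : Set (Vilenkin p)} {x : Vilenkin p} :
    x ∈ saturation S ↔ ∃ l : Lam p, x - (l : Vilenkin p) ∈ S := mem_iUnion

omit [NeZero p] in
theorem subset_saturation (S : Set (Vilenkin p)) : S ⊆ saturation S := fun x hx =>
  mem_saturation.2 ⟨0, by
    change x - 0 ∈ S
    rwa [sub_zero]⟩

omit [NeZero p] in
theorem measurableSet_saturation {S : Set (Vilenkin p)} (hS : MeasurableSet S) :
    MeasurableSet (saturation S) :=
  MeasurableSet.iUnion fun _ => measurable_sub_const _ hS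

omit [NeZero p] in
theorem add_mem_saturation_iff {S : Set (Vilenkin p)} :
    ∀ l ∈ Lam p, ∀ x, l + x ∈ saturation S ↔ x ∈ saturation S := by
  intro l hl x
  simp only [mem_saturation]
  refine ⟨fun ⟨m, hm⟩ => ⟨m - ⟨l, hl⟩, ?_⟩, fun ⟨m, hm⟩ => ⟨m + ⟨l, hl⟩, ?_⟩⟩
  · change x - (m - l) ∈ S
    rw [show x - (m - l) = l + x - m by abel]
    exact hm
  · change l + x - (m + l) ∈ S
    rw [show l + x - (m + l) = x - m by abel]
    exact hm

theorem measure_of_isAddFundamentalDomain {D : Set (Vilenkin p)}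
    (hD : IsAddFundamentalDomain (Lam p) D (mu p)) : mu p D = 1 := by
  rw [hD.measure_eq isAddFundamentalDomain_U, mu_U]

theorem setIntegral_chi_of_isAddFundamentalDomain {D : Set (Vilenkin p)}
    (hD : IsAddFundamentalDomain (Lam p) D (mu p)) {n : Vilenkin p} (hn : n ∈ Lam p)
    [Decidable (n = 0)] : ∫ ω in D, chi n ω ∂mu p = if n = 0 then 1 else 0 := by
  classical
  rw [hD.setIntegral_eq isAddFundamentalDomain_U (f := fun ω => chi n ω)
    fun l ω => chi_lam_add hn l.2 ω, setIntegral_U_chi]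
  exact if_congr ⟨fun h => eq_zero_of_mem_U_of_mem_Lam h hn, fun h => h ▸ zero_mem _⟩ rfl rfl

/-- The characters attached to `Λ` are complete on any fundamental domain `D` of `Λ`, already for
integrable functions. -/
theorem ae_eq_zero_of_setIntegral_mul_chi_eq_zero {D : Set (Vilenkin p)} (hDm : MeasurableSet D)
    (hD : IsAddFundamentalDomain (Lam p) D (mu p)) {h : Vilenkin p → ℂ}
    (hi : IntegrableOn h D (mu p)) (h0 : ∀ n ∈ Lam p, ∫ ω in D, h ω * chi n ω ∂mu p = 0) :
    ∀ᵐ ω ∂mu p, ω ∈ D → h ω = 0 := by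
  have hi' : Integrable (D.indicator h) (mu p) := hi.integrable_indicator hDm
  have h0' : ∀ n ∈ Lam p, ∫ ω, D.indicator h ω * chi n ω ∂mu p = 0 := by
    intro n hn
    rw [← h0 n hn, ← integral_indicator hDm]
    congr 1
    ext ω
    by_cases hω : ω ∈ D <;> simp [hω]
  have key : D.indicator h =ᵐ[mu p] 0 := by
    refine hi'.ae_eq_zero_of_forall_setIntegral_eq_zero fun S hS _ => ?_
    -- Up to a null set, `S ∩ D` is the trace on `D` of the `Λ`-invariant set that it generates.
    set B := saturation (S ∩ D)
    have hBm : MeasurableSet B := measurableSet_saturation (hS.inter hDm)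
    have hBinv := add_mem_saturation_iff (S := (S ∩ D))
    have hae : (B ∩ D : Set _) =ᵐ[mu p] (S ∩ D : Set _) := by
      have hnull : ∀ᵐ (x : Vilenkin p) ∂mu p, ∀ l : Lam p, l ≠ 0 → ¬ (x - l ∈ D ∧ x ∈ D) := by
        refine ae_all_iff.2 fun l => ?_
        by_cases hl : l = 0
        · simp [hl]
        have h0 : mu p ((l +ᵥ D) ∩ ((0 : Lam p) +ᵥ D)) = 0 := hD.aedisjoint hl
        filter_upwards [measure_eq_zero_iff_ae_notMem.1 h0] with x hx _ hx'
        refine hx ⟨lam_vadd_mem.2 hx'.1, ?_⟩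
        rw [zero_vadd]
        exact hx'.2
      filter_upwards [hnull] with x hx
      refine propext ⟨?_, fun hxS => ⟨subset_saturation _ hxS, hxS.2⟩⟩
      rintro ⟨hxB, hxD⟩
      obtain ⟨l, hl⟩ := mem_saturation.1 hxB
      by_cases hl0 : l = 0
      · subst hl0
        have hl' : x - 0 ∈ S ∩ D := hl
        rwa [sub_zero] at hl'
      · exact absurd ⟨hl.2, hxD⟩ (hx l hl0)
    have := setIntegral_eq_zero_of_lam_invariant hi' h0' hBm hBinv
    rw [setIntegral_indicator hDm] at this ⊢
    rwa [setIntegral_congr_set hae] at this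
  filter_upwards [key] with ω hω hωD
  rwa [indicator_of_mem hωD] at hω

/-! ### Wave packets -/

/-- The wave packet with carrier `D`, scale `j` and position `n`, on the Fourier side: the function
`ω ↦ p^{-j/2} 1_D(σ^j ω) χ(-n, σ^j ω)`. The inverse Fourier transform of `packet D j n` is
`ψ_{j,n}`, where `ψ` is that of `1_D`. -/
noncomputable def packet (D : Set (Vilenkin p)) (j : ℤ) (n : Vilenkin p) (ω : Vilenkin p) : ℂ :=
  (((p : ℝ) ^ (-(j : ℝ) / 2) : ℝ) : ℂ) * D.indicator (fun η => chi (-n) η) (sigmaPow p j ω)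

theorem rpow_half_mul_rpow_half (j : ℤ) :
    (((p : ℝ) ^ (-(j : ℝ) / 2) : ℝ) : ℂ) * ((p : ℝ) ^ j : ℝ) =
      (((p : ℝ) ^ ((j : ℝ) / 2) : ℝ) : ℂ) := by
  have hp : (0 : ℝ) < p := Nat.cast_pos.2 (NeZero.pos p)
  rw [← Complex.ofReal_mul, ← Real.rpow_intCast, ← Real.rpow_add hp]
  congr 2
  ring

theorem rpow_half_mul_rpow_neg_half (j : ℤ) :
    (((p : ℝ) ^ ((j : ℝ) / 2) : ℝ) : ℂ) * (((p : ℝ) ^ (-(j : ℝ) / 2) : ℝ) : ℂ) = 1 := by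
  have hp : (0 : ℝ) < p := Nat.cast_pos.2 (NeZero.pos p)
  rw [← Complex.ofReal_mul, ← Real.rpow_add hp]
  ring_nf
  simp

theorem rpow_ne_zero (r : ℝ) : (((p : ℝ) ^ r : ℝ) : ℂ) ≠ 0 := by
  have hp : (0 : ℝ) < p := Nat.cast_pos.2 (NeZero.pos p)
  exact Complex.ofReal_ne_zero.2 (Real.rpow_pos_of_pos hp r).ne'

theorem packet_eq_zero_iff {D : Set (Vilenkin p)} {j : ℤ} {n ω : Vilenkin p} :
    packet D j n ω = 0 ↔ sigmaPow p j ω ∉ D := by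
  unfold packet
  rw [mul_eq_zero, or_iff_right (rpow_ne_zero _), indicator_apply_eq_zero]
  have : chi (-n) (sigmaPow p j ω) ≠ 0 := by
    rw [← norm_ne_zero_iff, norm_chi]
    exact one_ne_zero
  exact ⟨fun h hD => this (h hD), fun h hD => absurd hD h⟩

theorem integrable_packet {D : Set (Vilenkin p)} (hDm : MeasurableSet D) (hD : mu p D < ⊤) (j : ℤ)
    (n : Vilenkin p) : Integrable (packet D j n) (mu p) := by
  have h : Integrable (D.indicator fun η => chi (-n) η) (mu p) := by
    rw [integrable_indicator_iff hDm]
    exact IntegrableOn.of_bound hD (continuous_chi_right _).aestronglyMeasurable 1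
      (Filter.Eventually.of_forall fun η => (norm_chi _ η).le)
  exact (integrable_comp_sigmaPow h j).const_mul _

theorem memLp_packet {D : Set (Vilenkin p)} (hDm : MeasurableSet D) (hD : mu p D < ⊤) (j : ℤ)
    (n : Vilenkin p) : MemLp (packet D j n) 2 (mu p) := by
  have hi := integrable_packet hDm hD j n
  refine (memLp_two_iff_integrable_sq_norm hi.aestronglyMeasurable).2 ?_
  refine (hi.norm.const_mul ((p : ℝ) ^ (-(j : ℝ) / 2))).congr
    (Filter.Eventually.of_forall fun ω => ?_)
  simp only [packet, norm_mul, Complex.norm_real, Real.norm_eq_abs]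
  rw [abs_of_nonneg (by positivity)]
  by_cases hω : sigmaPow p j ω ∈ D
  · rw [indicator_of_mem hω, norm_chi]
    ring
  · rw [indicator_of_notMem hω, norm_zero]
    ring

/-- The pairing of a wave packet with a function, transported to its carrier. -/
theorem integral_conj_packet_mul {D : Set (Vilenkin p)} (hDm : MeasurableSet D) (j : ℤ)
    (n : Vilenkin p) (f : Vilenkin p → ℂ) :
    ∫ ω, f ω * starRingEnd ℂ (packet D j n ω) ∂mu p =
      (((p : ℝ) ^ ((j : ℝ) / 2) : ℝ) : ℂ) * ∫ η in D, f (rhoPow p j η) * chi n η ∂mu p := by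
  have h : ∀ ω, f ω * starRingEnd ℂ (packet D j n ω) = (((p : ℝ) ^ (-(j : ℝ) / 2) : ℝ) : ℂ) *
      D.indicator (fun η => f (rhoPow p j η) * chi n η) (sigmaPow p j ω) := by
    intro ω
    unfold packet
    rw [map_mul, Complex.conj_ofReal]
    by_cases hω : sigmaPow p j ω ∈ D
    · rw [indicator_of_mem hω, indicator_of_mem hω, rhoPow_sigmaPow, ← chi_neg_left, neg_neg]
      ring
    · simp [indicator_of_notMem hω]
  simp_rw [h]
  rw [integral_const_mul, integral_comp_sigmaPow j
    (D.indicator fun η => f (rhoPow p j η) * chi n η), integral_indicator hDm, ← mul_assoc,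
    rpow_half_mul_rpow_half]

theorem integral_packet_mul_conj_packet {D : Set (Vilenkin p)} (hDm : MeasurableSet D) (j : ℤ)
    (n m : Vilenkin p) :
    ∫ ω, packet D j m ω * starRingEnd ℂ (packet D j n ω) ∂mu p = ∫ η in D, chi (n - m) η ∂mu p := by
  rw [integral_conj_packet_mul hDm, ← integral_const_mul]
  refine setIntegral_congr_fun hDm fun η hη => ?_
  simp only [packet, sigmaPow_rhoPow, indicator_of_mem hη]
  rw [← mul_assoc, ← mul_assoc, rpow_half_mul_rpow_neg_half, one_mul, ← chi_add_left,
    neg_add_eq_sub]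

theorem memLp_comp_rhoPow {f : Vilenkin p → ℂ} (hf : MemLp f 2 (mu p)) (j : ℤ) :
    MemLp (fun η => f (rhoPow p j η)) 2 (mu p) := by
  have h : MemLp f 2 ((mu p).map (rhoPow p j)) := by
    rw [map_rhoPow]
    exact hf.smul_measure ENNReal.ofReal_ne_top
  exact h.comp_of_map (continuous_rhoPow j).measurable.aemeasurable

/-- The wave packets carried by a fundamental domain `D`, at a fixed scale `j`, are complete on
`ρ^j(D)`. -/
theorem ae_eq_zero_of_integral_conj_packet_eq_zero {D : Set (Vilenkin p)} (hDm : MeasurableSet D)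
    (hD : IsAddFundamentalDomain (Lam p) D (mu p)) {j : ℤ} {f : Vilenkin p → ℂ}
    (hf : MemLp f 2 (mu p))
    (h0 : ∀ n ∈ Lam p, ∫ ω, f ω * starRingEnd ℂ (packet D j n ω) ∂mu p = 0) :
    ∀ᵐ ω ∂mu p, sigmaPow p j ω ∈ D → f ω = 0 := by
  have hfin : mu p D ≠ ⊤ := by
    rw [measure_of_isAddFundamentalDomain hD]
    exact ENNReal.one_ne_top
  have hi : IntegrableOn (fun η => f (rhoPow p j η)) D (mu p) := by
    have : IsFiniteMeasure ((mu p).restrict D) := isFiniteMeasure_restrict.2 hfin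
    exact ((memLp_comp_rhoPow hf j).restrict D).integrable one_le_two
  have key := ae_eq_zero_of_setIntegral_mul_chi_eq_zero hDm hD hi fun n hn => by
    have := h0 n hn
    rw [integral_conj_packet_mul hDm] at this
    exact (mul_eq_zero.1 this).resolve_left (rpow_ne_zero _)
  filter_upwards [(quasiMeasurePreserving_sigmaPow j).ae key] with ω hω hωD
  rw [← rhoPow_sigmaPow j ω]
  exact hω hωD

theorem inner_eq_integral_of_ae_eq {e f : Lp ℂ 2 (mu p)} {e' f' : Vilenkin p → ℂ}
    (he : e =ᵐ[mu p] e') (hf : f =ᵐ[mu p] f') :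
    inner ℂ e f = ∫ ω, f' ω * starRingEnd ℂ (e' ω) ∂mu p := by
  rw [L2.inner_def]
  refine integral_congr_ae ?_
  filter_upwards [he, hf] with ω h₁ h₂
  rw [h₁, h₂, RCLike.inner_apply]

theorem exists_hilbertBasis_reindex {ι κ E : Type*} [NormedAddCommGroup E] [InnerProductSpace ℂ E]
    [CompleteSpace E] (b : HilbertBasis ι ℂ E) (e : κ ≃ ι) :
    ∃ b' : HilbertBasis κ ℂ E, ∀ i, b' i = b (e i) := by
  refine ⟨HilbertBasis.mk (b.orthonormal.comp e e.injective) ?_, fun i => ?_⟩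
  · rw [e.surjective.range_comp]
    exact b.dense_span.ge
  · rw [HilbertBasis.coe_mk, Function.comp_apply]

/-- If the sets `ρ^{j i}(D i)` tile the group, where each `D i` is a fundamental domain of `Λ`, then
the wave packets that they carry form an orthonormal basis. -/
theorem exists_hilbertBasis_packet {ι : Type*} [Countable ι] {D : ι → Set (Vilenkin p)} {j : ι → ℤ}
    (hDm : ∀ i, MeasurableSet (D i)) (hD : ∀ i, IsAddFundamentalDomain (Lam p) (D i) (mu p))
    (hdisj : ∀ i i', i ≠ i' →
      ∀ᵐ ω ∂mu p, sigmaPow p (j i) ω ∈ D i → sigmaPow p (j i') ω ∉ D i')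
    (hcov : ∀ᵐ ω ∂mu p, ∃ i, sigmaPow p (j i) ω ∈ D i) :
    ∃ b : HilbertBasis (ι × Lam p) ℂ (Lp ℂ 2 (mu p)),
      ∀ i n, b (i, n) =ᵐ[mu p] packet (D i) (j i) n := by
  classical
  have hL : ∀ q : ι × Lam p, MemLp (packet (D q.1) (j q.1) q.2) 2 (mu p) := fun q =>
    memLp_packet (hDm _) (by
      rw [measure_of_isAddFundamentalDomain (hD _)]
      exact ENNReal.one_lt_top) _ _
  have hv : Orthonormal ℂ fun q => (hL q).toLp := by
    rw [orthonormal_iff_ite]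
    rintro ⟨i, n⟩ ⟨i', m⟩
    rw [inner_eq_integral_of_ae_eq (hL _).coeFn_toLp (hL _).coeFn_toLp]
    by_cases hi : i = i'
    · subst hi
      rw [integral_packet_mul_conj_packet (hDm i),
        setIntegral_chi_of_isAddFundamentalDomain (hD i) (sub_mem n.2 m.2)]
      refine if_congr ?_ rfl rfl
      rw [sub_eq_zero, Prod.mk.injEq, Subtype.ext_iff]
      simp
    · rw [if_neg fun h => hi (congrArg Prod.fst h)]
      refine integral_eq_zero_of_ae ?_
      filter_upwards [hdisj i i' hi] with ω hω
      rw [Pi.zero_apply, mul_eq_zero, map_eq_zero, packet_eq_zero_iff, packet_eq_zero_iff]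
      tauto
  refine ⟨HilbertBasis.mkOfOrthogonalEqBot hv ?_, fun i n => ?_⟩
  · refine (Submodule.eq_bot_iff _).2 fun f hf => ?_
    have key : ∀ᵐ ω ∂mu p, ∀ i, sigmaPow p (j i) ω ∈ D i → f ω = 0 := ae_all_iff.2 fun i => by
      refine ae_eq_zero_of_integral_conj_packet_eq_zero (hDm i) (hD i) (Lp.memLp f) fun n hn => ?_
      rw [← inner_eq_integral_of_ae_eq (hL (i, ⟨n, hn⟩)).coeFn_toLp (Filter.EventuallyEq.refl _ f)]
      exact (Submodule.mem_orthogonal _ _).1 hf _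
        (Submodule.subset_span (mem_range_self (i, (⟨n, hn⟩ : Lam p))))
    refine (Lp.eq_zero_iff_ae_eq_zero).2 ?_
    filter_upwards [key, hcov] with ω h₁ ⟨i, hi⟩
    exact h₁ i hi
  · rw [HilbertBasis.coe_mkOfOrthogonalEqBot]
    exact (hL (i, n)).coeFn_toLp

/-! ### Plancherel's theorem -/

theorem setIntegral_coset_chi (n ω : Vilenkin p) [Decidable (ω ∈ U p)] :
    ∫ x in coset n, chi x ω ∂mu p = if ω ∈ U p then chi n ω else 0 := by
  have h := integral_add_right_eq_self (μ := mu p) ((coset n).indicator fun x => chi x ω) n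
  have h' : ∀ x, (coset n).indicator (fun x => chi x ω) (x + n) =
      (U p : Set (Vilenkin p)).indicator (fun x => chi n ω * chi ω x) x := by
    intro x
    have hiff : x + n ∈ coset n ↔ x ∈ (U p : Set (Vilenkin p)) := by
      change x + n - n ∈ U p ↔ _
      rw [add_sub_cancel_right]
      rfl
    by_cases hx : x ∈ (U p : Set (Vilenkin p))
    · rw [indicator_of_mem hx, indicator_of_mem (hiff.2 hx), chi_add_left, chi_comm x, mul_comm]
    · rw [indicator_of_notMem hx, indicator_of_notMem (mt hiff.1 hx)]
  simp_rw [h'] at h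
  rw [integral_indicator measurableSet_U, integral_indicator (measurableSet_coset n),
    integral_const_mul, setIntegral_U_chi] at h
  rw [← h]
  split_ifs <;> simp

theorem integrable_prod_mul_chi {f : Vilenkin p → ℂ} (hf : Integrable f (mu p))
    {A : Set (Vilenkin p)} (hA : mu p A ≠ ⊤) (l : Vilenkin p) :
    Integrable (fun q : Vilenkin p × Vilenkin p => f q.2 * chi q.1 q.2 * chi l q.1)
      (((mu p).restrict A).prod (mu p)) := by
  have : IsFiniteMeasure ((mu p).restrict A) := isFiniteMeasure_restrict.2 hA
  have h1 : Integrable (fun q : Vilenkin p × Vilenkin p => f q.2)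
      (((mu p).restrict A).prod (mu p)) := hf.comp_snd _
  have h2 : AEStronglyMeasurable (fun q : Vilenkin p × Vilenkin p => chi q.1 q.2)
      (((mu p).restrict A).prod (mu p)) := continuous_chi.aestronglyMeasurable
  have h3 : AEStronglyMeasurable (fun q : Vilenkin p × Vilenkin p => chi l q.1)
      (((mu p).restrict A).prod (mu p)) :=
    ((continuous_chi_right l).comp continuous_fst).aestronglyMeasurable
  exact (h1.mul_bdd h2 (Filter.Eventually.of_forall fun q => (norm_chi _ _).le)).mul_bdd h3
    (Filter.Eventually.of_forall fun q => (norm_chi _ _).le)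

theorem integrableOn_invFourier {f : Vilenkin p → ℂ} (hf : Integrable f (mu p))
    {A : Set (Vilenkin p)} (hA : mu p A ≠ ⊤) : IntegrableOn (invFourier f) A (mu p) := by
  have h := (integrable_prod_mul_chi hf hA 0).integral_prod_left
  simp only [chi_zero_left, mul_one] at h
  exact h

/-- The inverse Fourier transform interchanges the two parameters of the wave packets on the cosets
of `U`; this is the dual form, for an arbitrary integrable `f`. -/
theorem setIntegral_coset_invFourier {f : Vilenkin p → ℂ} (hf : Integrable f (mu p))
    {n l : Vilenkin p} (hn : n ∈ Lam p) (hl : l ∈ Lam p) :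
    ∫ x in coset n, invFourier f x * chi l x ∂mu p = ∫ ω in coset (-l), f ω * chi n ω ∂mu p := by
  classical
  have hA : mu p (coset n) ≠ ⊤ := by
    rw [measure_of_isAddFundamentalDomain (isAddFundamentalDomain_coset hn)]
    exact ENNReal.one_ne_top
  have hswap := integral_integral_swap (f := fun x ω => f ω * chi x ω * chi l x)
    (integrable_prod_mul_chi hf hA l)
  have e1 : ∀ x, ∫ ω, f ω * chi x ω * chi l x ∂mu p = invFourier f x * chi l x := fun x => by
    rw [integral_mul_const]
    rfl
  have e2 : ∀ ω, ∫ x in coset n, f ω * chi x ω * chi l x ∂mu p =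
      (coset (-l)).indicator (fun ω => f ω * chi n ω) ω := by
    intro ω
    have : ∀ x, f ω * chi x ω * chi l x = f ω * chi x (ω + l) := fun x => by
      rw [chi_add_right, chi_comm l, mul_assoc]
    simp_rw [this]
    rw [integral_const_mul, setIntegral_coset_chi]
    have hiff : ω + l ∈ U p ↔ ω ∈ coset (-l) := by
      change _ ↔ ω - -l ∈ U p
      rw [sub_neg_eq_add]
    rw [indicator_apply, chi_add_right, chi_eq_one_of_mem_Lam hn hl, mul_one]
    simp only [hiff]
    split_ifs <;> simp
  simp_rw [e1, e2] at hswap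
  rw [hswap, integral_indicator (measurableSet_coset _)]

theorem exists_hilbertBasis_coset : ∃ b : HilbertBasis (Lam p × Lam p) ℂ (Lp ℂ 2 (mu p)),
    ∀ l n : Lam p, b (l, n) =ᵐ[mu p] packet (coset (l : Vilenkin p)) 0 n := by
  have h0 : ∀ ω : Vilenkin p, sigmaPow p 0 ω = ω := fun ω => by
    ext j
    rw [sigmaPow_apply, sub_zero]
  refine exists_hilbertBasis_packet (D := fun l : Lam p => coset (l : Vilenkin p)) (j := fun _ => 0)
    (fun l => measurableSet_coset _) (fun l => isAddFundamentalDomain_coset l.2) ?_ ?_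
  · refine fun l m hlm => Filter.Eventually.of_forall fun ω h₁ h₂ => hlm ?_
    exact Subtype.ext (eq_of_sub_mem_U l.2 m.2 h₁ h₂)
  · refine Filter.Eventually.of_forall fun ω => ⟨⟨ω - frac ω, sub_frac_mem_Lam ω⟩, ?_⟩
    rw [h0]
    exact sub_sub_frac_mem_U ω

/-- **Plancherel's theorem**: the inverse Fourier transform extends from `L¹ ∩ L²` to a unitary
operator of `L²`. The operator is defined by permuting the orthonormal basis of the
wave packets on the cosets of `U`. -/
theorem exists_linearIsometryEquiv_invFourier :
    ∃ F : Lp ℂ 2 (mu p) ≃ₗᵢ[ℂ] Lp ℂ 2 (mu p), ∀ (f : Vilenkin p → ℂ) (hf : MemLp f 2 (mu p)),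
      Integrable f (mu p) → F hf.toLp =ᵐ[mu p] invFourier f := by
  classical
  obtain ⟨b, hb⟩ := exists_hilbertBasis_coset (p := p)
  -- The inverse Fourier transform takes the packet with carrier `l + U` and position `n` to the one
  -- with carrier `n + U` and position `-l`.
  obtain ⟨b', hb'⟩ := exists_hilbertBasis_reindex b
    ((Equiv.prodComm (Lam p) (Lam p)).trans (Equiv.prodCongr (Equiv.refl _) (Equiv.neg _)))
  have hb' : ∀ l n, b' (l, n) = b (n, -l) := fun l n => hb' (l, n)
  let F := b.repr.trans b'.repr.symm
  have hF : ∀ i, F (b i) = b' i := fun i => by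
    rw [LinearIsometryEquiv.trans_apply, b.repr_self, b'.repr_symm_single]
  refine ⟨F, fun f hf hi => ?_⟩
  have hone : ∀ n : Lam p, mu p (coset (n : Vilenkin p)) ≠ ⊤ := fun n => by
    rw [measure_of_isAddFundamentalDomain (isAddFundamentalDomain_coset n.2)]
    exact ENNReal.one_ne_top
  have hcoef : ∀ (g : Lp ℂ 2 (mu p)) (g' : Vilenkin p → ℂ), g =ᵐ[mu p] g' → ∀ n l : Lam p,
      inner ℂ (b (n, l)) g = ∫ x in coset (n : Vilenkin p), g' x * chi l x ∂mu p := by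
    intro g g' hg n l
    rw [inner_eq_integral_of_ae_eq (hb n l) hg, integral_conj_packet_mul (measurableSet_coset _)]
    have h0 : ∀ η : Vilenkin p, rhoPow p 0 η = η := fun η => by
      ext j
      rw [rhoPow_apply, add_zero]
    simp [h0]
  have key : ∀ n : Lam p, ∀ᵐ x ∂mu p, x ∈ coset (n : Vilenkin p) →
      F hf.toLp x - invFourier f x = 0 := by
    intro n
    have hiF : IntegrableOn (F hf.toLp) (coset (n : Vilenkin p)) (mu p) := by
      have : IsFiniteMeasure ((mu p).restrict (coset (n : Vilenkin p))) :=
        isFiniteMeasure_restrict.2 (hone n)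
      exact ((Lp.memLp (F hf.toLp)).restrict _).integrable one_le_two
    have hif := integrableOn_invFourier hi (hone n)
    refine ae_eq_zero_of_setIntegral_mul_chi_eq_zero (measurableSet_coset _)
      (isAddFundamentalDomain_coset n.2) (hiF.sub hif) fun l hl => ?_
    have hbdd : ∀ {g : Vilenkin p → ℂ}, IntegrableOn g (coset (n : Vilenkin p)) (mu p) →
        IntegrableOn (fun x => g x * chi l x) (coset (n : Vilenkin p)) (mu p) := fun hg =>
      Integrable.mul_bdd (c := 1) hg (continuous_chi_right l).aestronglyMeasurable
        (Filter.Eventually.of_forall fun x => (norm_chi _ _).le)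
    simp_rw [sub_mul]
    rw [integral_sub (hbdd hiF) (hbdd hif), sub_eq_zero, setIntegral_coset_invFourier hi n.2 hl]
    rw [← hcoef _ _ (Filter.EventuallyEq.refl _ _) n ⟨l, hl⟩]
    have h1 : b (n, ⟨l, hl⟩) = F (b (-⟨l, hl⟩, n)) := by
      rw [hF, hb', neg_neg]
    rw [h1, LinearIsometryEquiv.inner_map_map, hcoef _ _ hf.coeFn_toLp]
    rfl
  filter_upwards [ae_all_iff.2 key] with x hx
  exact sub_eq_zero.1 (hx ⟨x - frac x, sub_frac_mem_Lam x⟩ (sub_sub_frac_mem_U x))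

theorem invFourier_packet (D : Set (Vilenkin p)) (j : ℤ) (n : Vilenkin p) :
    invFourier (packet D j n) = affine (invFourier (D.indicator fun _ => 1)) j n := by
  ext x
  have h : ∀ ω, packet D j n ω * chi x ω = (((p : ℝ) ^ (-(j : ℝ) / 2) : ℝ) : ℂ) *
      D.indicator (fun η => chi (rhoPow p j x - n) η) (sigmaPow p j ω) := by
    intro ω
    unfold packet
    by_cases hω : sigmaPow p j ω ∈ D
    · rw [indicator_of_mem hω, indicator_of_mem hω, sub_eq_add_neg, chi_add_left, chi_rhoPow,
        rhoPow_sigmaPow]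
      ring
    · simp [indicator_of_notMem hω]
  unfold affine invFourier
  simp_rw [h]
  rw [integral_const_mul, integral_comp_sigmaPow j
    (D.indicator fun η => chi (rhoPow p j x - n) η), ← mul_assoc, rpow_half_mul_rpow_half]
  congr 2
  ext η
  by_cases hη : η ∈ D <;> simp [hη]

/-- On the Fourier side, the affine system of a wavelet set is a system of wave packets. -/
theorem isWaveletSet_iff {Ω : Idx p → Set (Vilenkin p)} (hΩ : ∀ u, MeasurableSet (Ω u)) :
    IsWaveletSet Ω ↔ (∀ u, mu p (Ω u) < ⊤) ∧
      ∃ b : HilbertBasis (Idx p × ℤ × Lam p) ℂ (Lp ℂ 2 (mu p)),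
        ∀ (u : Idx p) (j : ℤ) (n : Lam p), b (u, j, n) =ᵐ[mu p] packet (Ω u) j n := by
  classical
  obtain ⟨F, hF⟩ := exists_linearIsometryEquiv_invFourier (p := p)
  refine and_congr_right fun hfin => ?_
  have hL : ∀ u j (n : Vilenkin p), MemLp (packet (Ω u) j n) 2 (mu p) := fun u j n =>
    memLp_packet (hΩ u) (hfin u) j n
  have hFp : ∀ u j (n : Vilenkin p), F (hL u j n).toLp =ᵐ[mu p]
      affine (invFourier ((Ω u).indicator fun _ => 1)) j n := fun u j n => by
    rw [← invFourier_packet]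
    exact hF _ _ (integrable_packet (hΩ u) (hfin u) j n)
  constructor
  · rintro ⟨b, hb⟩
    refine ⟨HilbertBasis.ofRepr (F.trans b.repr), fun u j n => ?_⟩
    have h1 : b (u, j, n) = F (hL u j n).toLp := Lp.ext ((hb u j n).trans (hFp u j n).symm)
    have h2 : (HilbertBasis.ofRepr (F.trans b.repr)) (u, j, n) = (hL u j n).toLp := by
      rw [← HilbertBasis.repr_symm_single, LinearIsometryEquiv.symm_apply_eq]
      change _ = b.repr (F _)
      rw [← h1, b.repr_self]
    rw [h2]
    exact (hL u j n).coeFn_toLp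
  · rintro ⟨b, hb⟩
    refine ⟨HilbertBasis.ofRepr (F.symm.trans b.repr), fun u j n => ?_⟩
    have h1 : b (u, j, n) = (hL u j n).toLp := Lp.ext ((hb u j n).trans (hL u j n).coeFn_toLp.symm)
    have h2 : (HilbertBasis.ofRepr (F.symm.trans b.repr)) (u, j, n) = F (hL u j n).toLp := by
      rw [← HilbertBasis.repr_symm_single, LinearIsometryEquiv.symm_apply_eq]
      change _ = b.repr (F.symm _)
      rw [F.symm_apply_apply, ← h1, b.repr_self]
    rw [h2]
    exact hFp u j n

/-! ### Translation congruence and fundamental domains -/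

omit [NeZero p] in
theorem mem_image_sub {x n : Vilenkin p} {S : Set (Vilenkin p)} :
    x ∈ (fun ω => ω - n) '' S ↔ x + n ∈ S := by
  constructor
  · rintro ⟨y, hy, rfl⟩
    rwa [sub_add_cancel]
  · exact fun h => ⟨x + n, h, add_sub_cancel_right x n⟩

theorem ae_add_of_ae {q : Vilenkin p → Prop} (h : ∀ᵐ x ∂mu p, q x) (l : Vilenkin p) :
    ∀ᵐ x ∂mu p, q (x + l) :=
  (measurePreserving_add_right (mu p) l).quasiMeasurePreserving.ae h

/-- A set is `Λ`-translation congruent to `U` exactly if it is a fundamental domain of `Λ` up to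
null sets: the pieces can only be the traces of the cosets of `U`. -/
theorem translationCongruent_U_iff {D : Set (Vilenkin p)} (hD : MeasurableSet D) :
    TranslationCongruent D (U p : Set (Vilenkin p)) ↔
      IsAddFundamentalDomain (Lam p) D (mu p) := by
  constructor
  · rintro ⟨N, P, hN, ⟨-, -, hPD⟩, hover, hsub, hcov⟩
    have hpiece : ∀ ω ∈ D, ∃ n ∈ N, ω ∈ P n ∧ ω - n ∈ U p := by
      intro ω hω
      rw [← hPD] at hω
      obtain ⟨n, hn, hωn⟩ := mem_iUnion₂.1 hω
      exact ⟨n, hn, hωn, hsub (mem_iUnion₂.2 ⟨n, hn, ω, hωn, rfl⟩)⟩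
    refine ⟨hD.nullMeasurableSet, ?_, ?_⟩
    -- Almost every point of `U` has a `Λ`-translate in `D`; hence so has almost every point.
    · have h1 : ∀ᵐ x ∂mu p, x ∈ U p → ∃ l ∈ Lam p, l + x ∈ D := by
        filter_upwards [measure_eq_zero_iff_ae_notMem.1 hcov] with x hx hxU
        by_contra! hcon
        refine hx ⟨hxU, fun hx' => ?_⟩
        obtain ⟨n, hn, hxn⟩ := mem_iUnion₂.1 hx'
        refine hcon n (hN hn) ?_
        rw [← hPD, add_comm]
        exact mem_iUnion₂.2 ⟨n, hn, mem_image_sub.1 hxn⟩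
      have h2 : ∀ᵐ (x : Vilenkin p) ∂mu p, ∀ m : Lam p, x + (m : Vilenkin p) ∈ U p →
          ∃ l ∈ Lam p, l + (x + m) ∈ D := ae_all_iff.2 fun m => ae_add_of_ae h1 m
      filter_upwards [h2] with x hx
      have hm : -(x - frac x) ∈ Lam p := neg_mem (sub_frac_mem_Lam x)
      obtain ⟨l, hl, hlx⟩ := hx ⟨_, hm⟩ (by
        change x + -(x - frac x) ∈ U p
        rw [neg_sub, add_sub_cancel]
        exact frac_mem_U x)
      refine ⟨⟨l + -(x - frac x), add_mem hl hm⟩, ?_⟩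
      change l + -(x - frac x) + x ∈ D
      rw [add_assoc, add_comm _ x]
      exact hlx
    -- A point of `(a + P m) ∩ (b + P n)` has its fractional part in `P m - m` and in `P n - n`.
    · intro a b hab
      have hnull : ∀ᵐ (x : Vilenkin p) ∂mu p, ∀ m n : Lam p, (m : Vilenkin p) ∈ N →
          (n : Vilenkin p) ∈ N → m ≠ n →
          ¬ (x - (a + m : Vilenkin p) + m ∈ P m ∧ x - (a + m : Vilenkin p) + n ∈ P n) := by
        refine ae_all_iff.2 fun m => ae_all_iff.2 fun n => ?_
        by_cases hm : (m : Vilenkin p) ∈ N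
        swap
        · simp [hm]
        by_cases hn : (n : Vilenkin p) ∈ N
        swap
        · simp [hn]
        by_cases hmn : m = n
        · simp [hmn]
        have h := hover m hm n hn (mt Subtype.ext hmn)
        filter_upwards [ae_add_of_ae (measure_eq_zero_iff_ae_notMem.1 h) (-(a + m : Vilenkin p))]
          with x hx _ _ _ hx'
        rw [← sub_eq_add_neg] at hx
        exact hx ⟨mem_image_sub.2 hx'.1, mem_image_sub.2 hx'.2⟩
      change mu p ((a +ᵥ D) ∩ (b +ᵥ D)) = 0
      refine measure_eq_zero_iff_ae_notMem.2 ?_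
      filter_upwards [hnull] with x hx hxab
      have hxa := lam_vadd_mem.1 hxab.1
      have hxb := lam_vadd_mem.1 hxab.2
      obtain ⟨m, hm, hPm, hUm⟩ := hpiece _ hxa
      obtain ⟨n, hn, hPn, hUn⟩ := hpiece _ hxb
      rw [sub_sub] at hUm hUn
      have hsum : (a + m : Vilenkin p) = b + n :=
        eq_of_sub_mem_U (add_mem a.2 (hN hm)) (add_mem b.2 (hN hn)) hUm hUn
      refine hx ⟨m, hN hm⟩ ⟨n, hN hn⟩ hm hn (fun hmn => hab ?_) ⟨?_, ?_⟩
      · have hmn : m = n := congrArg Subtype.val hmn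
        rw [hmn] at hsum
        exact Subtype.ext (add_right_cancel hsum)
      · change x - (a + m) + m ∈ P m
        rw [show x - (a + m) + m = x - a by abel]
        exact hPm
      · change x - (a + m) + n ∈ P n
        rw [hsum, show x - (b + n) + n = x - b by abel]
        exact hPn
  · intro h
    refine ⟨{n | n ∈ Lam p ∧ (D ∩ coset n).Nonempty}, fun n => D ∩ coset n, fun n hn => hn.1,
      ⟨fun n hn => ⟨hD.inter (measurableSet_coset n), hn.2⟩, ?_, ?_⟩, ?_, ?_, ?_⟩
    · exact fun m hm n hn hmn => Set.disjoint_left.2 fun x hxm hxn =>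
        hmn (eq_of_sub_mem_U hm.1 hn.1 hxm.2 hxn.2)
    · refine Subset.antisymm (iUnion₂_subset fun n _ => inter_subset_left) fun x hx => ?_
      have hx' : x ∈ D ∩ coset (x - frac x) := ⟨hx, sub_sub_frac_mem_U x⟩
      have hN : x - frac x ∈ {n | n ∈ Lam p ∧ (D ∩ coset n).Nonempty} :=
        ⟨sub_frac_mem_Lam x, x, hx'⟩
      exact mem_iUnion₂.2 ⟨x - frac x, hN, hx'⟩
    · rintro m ⟨hm, -⟩ n ⟨hn, -⟩ hmn
      have hne : (⟨-m, neg_mem hm⟩ : Lam p) ≠ ⟨-n, neg_mem hn⟩ := fun h =>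
        hmn (neg_injective (congrArg Subtype.val h))
      have h0 : mu p (((⟨-m, neg_mem hm⟩ : Lam p) +ᵥ D) ∩ ((⟨-n, neg_mem hn⟩ : Lam p) +ᵥ D)) = 0 :=
        h.aedisjoint hne
      refine measure_mono_null ?_ h0
      intro x hx
      refine ⟨?_, ?_⟩
      · rw [lam_vadd_mem]
        change x - -m ∈ D
        rw [sub_neg_eq_add]
        exact (mem_image_sub.1 hx.1).1
      · rw [lam_vadd_mem]
        change x - -n ∈ D
        rw [sub_neg_eq_add]
        exact (mem_image_sub.1 hx.2).1
    · refine iUnion₂_subset fun n _ => ?_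
      rintro _ ⟨x, hx, rfl⟩
      exact hx.2
    · refine measure_eq_zero_iff_ae_notMem.2 ?_
      filter_upwards [h.ae_covers] with x hx hx'
      obtain ⟨l, hl⟩ := hx
      have hl' : x + l ∈ D ∩ coset (l : Vilenkin p) := ⟨by rw [add_comm]; exact hl, by
        change x + l - l ∈ U p
        rw [add_sub_cancel_right]
        exact hx'.1⟩
      exact hx'.2 (mem_iUnion₂.2 ⟨l, ⟨l.2, _, hl'⟩, mem_image_sub.2 hl'⟩)

/-- Orthonormality of the characters attached to `Λ` on a set `D` of finite measure forces `D` to be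
a fundamental domain of `Λ`: its periodized indicator function has the Fourier coefficients
of the constant function `1`. -/
theorem isAddFundamentalDomain_of_setIntegral_chi {D : Set (Vilenkin p)} (hDm : MeasurableSet D)
    (hfin : mu p D < ⊤)
    (h : ∀ n ∈ Lam p, ∫ ω in D, chi n ω ∂mu p = ∫ ω in (U p : Set (Vilenkin p)), chi n ω ∂mu p) :
    IsAddFundamentalDomain (Lam p) D (mu p) := by
  have hUfin : mu p (U p : Set (Vilenkin p)) < ⊤ := by
    rw [mu_U]
    exact ENNReal.one_lt_top
  have hmeas : ∀ B, MeasurableSet B → (∀ l ∈ Lam p, ∀ x, l + x ∈ B ↔ x ∈ B) →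
      mu p (B ∩ D) = mu p (B ∩ U p) := by
    intro B hB hinv
    have hiD : Integrable (D.indicator fun _ => (1 : ℂ)) (mu p) :=
      (integrable_indicator_iff hDm).2 (integrableOn_const hfin.ne)
    have hiU : Integrable ((U p : Set (Vilenkin p)).indicator fun _ => (1 : ℂ)) (mu p) :=
      (integrable_indicator_iff measurableSet_U).2 (integrableOn_const hUfin.ne)
    have hmul : ∀ (A : Set (Vilenkin p)) (n ω : Vilenkin p),
        A.indicator (fun _ => (1 : ℂ)) ω * chi n ω = A.indicator (fun ω => chi n ω) ω := by
      intro A n ω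
      by_cases hω : ω ∈ A <;> simp [hω]
    have key := setIntegral_eq_zero_of_lam_invariant (hiD.sub hiU) (fun n hn => by
      simp only [Pi.sub_apply, sub_mul]
      rw [integral_sub (integrable_mul_chi hiD n) (integrable_mul_chi hiU n)]
      simp_rw [hmul]
      rw [integral_indicator hDm, integral_indicator measurableSet_U, h n hn, sub_self]) hB hinv
    simp only [Pi.sub_apply] at key
    rw [integral_sub hiD.integrableOn hiU.integrableOn, setIntegral_indicator hDm,
      setIntegral_indicator measurableSet_U, sub_eq_zero] at key
    simp only [integral_const, mul_one, Complex.real_smul, Complex.ofReal_inj,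
      Measure.real, Measure.restrict_apply_univ] at key
    exact (ENNReal.toReal_eq_toReal_iff' (measure_lt_top_of_subset inter_subset_right hfin.ne).ne
      (measure_lt_top_of_subset inter_subset_right hUfin.ne).ne).1 key
  refine ⟨hDm.nullMeasurableSet, ?_, ?_⟩
  · set B : Set (Vilenkin p) := (saturation D)ᶜ with hB
    have hBm : MeasurableSet B := (measurableSet_saturation hDm).compl
    have hBinv : ∀ l ∈ Lam p, ∀ x, l + x ∈ B ↔ x ∈ B := fun l hl x =>
      not_congr (add_mem_saturation_iff l hl x)
    have hBD : B ∩ D = ∅ :=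
      eq_empty_of_forall_notMem fun x hx => hx.1 (subset_saturation D hx.2)
    have h0 := hmeas B hBm hBinv
    rw [hBD, measure_empty] at h0
    have hB0 : mu p B = 0 := by
      refine isAddFundamentalDomain_U.measure_zero_of_invariant B (fun l => ?_) h0.symm
      ext x
      rw [lam_vadd_mem, ← hBinv l l.2 (x - l), add_sub_cancel]
    filter_upwards [measure_eq_zero_iff_ae_notMem.1 hB0] with x hx
    rw [hB, notMem_compl_iff] at hx
    obtain ⟨l, hl⟩ := mem_saturation.1 hx
    refine ⟨-l, ?_⟩
    change -(l : Vilenkin p) + x ∈ D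
    rw [neg_add_eq_sub]
    exact hl
    -- A set `S ⊆ D` inside one coset of `U` with `S - l ⊆ D` generates an invariant set whose trace
    -- on `U` has the measure of `S`, while its trace on `D` contains both `S` and `S - l`.
  · have hdouble : ∀ l m : Lam p, l ≠ 0 →
        mu p ({x : Vilenkin p | x ∈ D ∧ x - (l : Vilenkin p) ∈ D} ∩
          coset (m : Vilenkin p)) = 0 := by
      intro l m hl
      set S : Set (Vilenkin p) :=
        {x : Vilenkin p | x ∈ D ∧ x - (l : Vilenkin p) ∈ D} ∩ coset (m : Vilenkin p) with hS
      have hSm : MeasurableSet S :=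
        (hDm.inter (measurable_sub_const _ hDm)).inter (measurableSet_coset _)
      set S' : Set (Vilenkin p) := {x | x + l ∈ S} with hS'
      have hS'm : MeasurableSet S' := measurable_add_const _ hSm
      have hSS' : mu p S' = mu p S := measure_preimage_add_right (mu p) (l : Vilenkin p) S
      have hdisj : Disjoint S S' := by
        refine Set.disjoint_left.2 fun x hx hx' => hl (Subtype.ext ?_)
        have h1 : x - m ∈ U p := hx.2
        have h2 : x + l - m ∈ U p := hx'.2
        have h3 : (l : Vilenkin p) ∈ U p := by
          have := sub_mem h2 h1
          rwa [show x + l - m - (x - m) = (l : Vilenkin p) by abel] at this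
        exact eq_zero_of_mem_U_of_mem_Lam h3 l.2
      have hm := hmeas _ (measurableSet_saturation hSm) add_mem_saturation_iff
      have hle : mu p S + mu p S' ≤ mu p (saturation S ∩ D) := by
        rw [← measure_union hdisj hS'm]
        refine measure_mono (union_subset (fun x hx => ⟨subset_saturation S hx, hx.1.1⟩)
          fun x hx => ⟨mem_saturation.2 ⟨-l, ?_⟩, ?_⟩)
        · change x - -(l : Vilenkin p) ∈ S
          rw [sub_neg_eq_add]
          exact hx
        · have : x + l - l ∈ D := hx.1.2
          rwa [add_sub_cancel_right] at this
      have hge : mu p (saturation S ∩ U p) ≤ mu p S := by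
        rw [← measure_preimage_add_right (mu p) (m : Vilenkin p) S]
        refine measure_mono ?_
        rintro x ⟨hx, hxU⟩
        obtain ⟨k, hk'⟩ := mem_saturation.1 hx
        have h1 : x - k - m ∈ U p := hk'.2
        have h2 : (k + m : Vilenkin p) = 0 := by
          refine eq_of_sub_mem_U (x := x) (add_mem k.2 m.2) (zero_mem _) ?_ ?_
          · rw [← sub_sub]; exact h1
          · rw [sub_zero]; exact hxU
        change x + m ∈ S
        rw [eq_neg_of_add_eq_zero_right h2, ← sub_eq_add_neg]
        exact hk'
      rw [hSS', hm] at hle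
      have hSfin : mu p S ≠ ⊤ :=
        (measure_lt_top_of_subset (fun x hx => hx.1.1 : S ⊆ D) hfin.ne).ne
      have h2 : mu p S + mu p S ≤ mu p S + 0 := by
        rw [add_zero]
        exact hle.trans hge
      exact nonpos_iff_eq_zero.1 ((ENNReal.add_le_add_iff_left hSfin).1 h2)
    intro a b hab
    change mu p ((a +ᵥ D) ∩ (b +ᵥ D)) = 0
    have hae : ∀ᵐ (x : Vilenkin p) ∂mu p, ∀ m : Lam p,
        ¬ (x + -(a : Vilenkin p) ∈
          {x : Vilenkin p | x ∈ D ∧ x - ((b - a : Lam p) : Vilenkin p) ∈ D} ∩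
            coset (m : Vilenkin p)) :=
      ae_all_iff.2 fun m => ae_add_of_ae (measure_eq_zero_iff_ae_notMem.1
        (hdouble (b - a) m (sub_ne_zero.2 hab.symm))) _
    refine measure_eq_zero_iff_ae_notMem.2 ?_
    filter_upwards [hae] with x hx hxab
    have hxa := lam_vadd_mem.1 hxab.1
    have hxb := lam_vadd_mem.1 hxab.2
    refine hx ⟨x - a.1 - frac (x - a.1), sub_frac_mem_Lam _⟩ ⟨⟨?_, ?_⟩, ?_⟩
    · rwa [← sub_eq_add_neg]
    · change x + -(a : Vilenkin p) - (b - a) ∈ D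
      rwa [show x + -(a : Vilenkin p) - (b - a) = x - b by abel]
    · change x + -(a : Vilenkin p) - (x - a.1 - frac (x - a.1)) ∈ U p
      rw [← sub_eq_add_neg, sub_sub_cancel]
      exact frac_mem_U _

/-! ### Orthonormal bases of wave packets -/

section Necessity

variable {Ω : Idx p → Set (Vilenkin p)} {b : HilbertBasis (Idx p × ℤ × Lam p) ℂ (Lp ℂ 2 (mu p))}

theorem isAddFundamentalDomain_of_hilbertBasis (hΩ : ∀ u, MeasurableSet (Ω u))
    (hfin : ∀ u, mu p (Ω u) < ⊤)
    (hb : ∀ (u : Idx p) (j : ℤ) (n : Lam p), b (u, j, n) =ᵐ[mu p] packet (Ω u) j n) (u : Idx p) :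
    IsAddFundamentalDomain (Lam p) (Ω u) (mu p) := by
  classical
  refine isAddFundamentalDomain_of_setIntegral_chi (hΩ u) (hfin u) fun n hn => ?_
  have h := orthonormal_iff_ite.1 b.orthonormal (u, 0, ⟨n, hn⟩) (u, 0, 0)
  rw [inner_eq_integral_of_ae_eq (hb _ _ _) (hb _ _ _), integral_packet_mul_conj_packet (hΩ u)] at h
  rw [setIntegral_chi_of_isAddFundamentalDomain isAddFundamentalDomain_U hn]
  simpa [Subtype.ext_iff] using h

theorem ae_disjoint_of_hilbertBasis (hΩ : ∀ u, MeasurableSet (Ω u)) (hfin : ∀ u, mu p (Ω u) < ⊤)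
    (hb : ∀ (u : Idx p) (j : ℤ) (n : Lam p), b (u, j, n) =ᵐ[mu p] packet (Ω u) j n)
    {u v : Idx p} {j k : ℤ} (hne : u ≠ v ∨ j ≠ k) :
    ∀ᵐ ω ∂mu p, sigmaPow p j ω ∈ Ω u → sigmaPow p k ω ∉ Ω v := by
  have key := ae_eq_zero_of_integral_conj_packet_eq_zero (hΩ u)
    (isAddFundamentalDomain_of_hilbertBasis hΩ hfin hb u) (j := j)
    (memLp_packet (hΩ v) (hfin v) k (0 : Lam p)) fun n hn => by
      rw [show packet (Ω u) j n = packet (Ω u) j (⟨n, hn⟩ : Lam p) from rfl,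
        ← inner_eq_integral_of_ae_eq (hb u j ⟨n, hn⟩) (hb v k 0)]
      refine b.orthonormal.2 fun h => ?_
      simp only [Prod.mk.injEq] at h
      tauto
  simpa only [packet_eq_zero_iff] using key

theorem ae_cover_of_hilbertBasis (hΩ : ∀ u, MeasurableSet (Ω u))
    (hb : ∀ (u : Idx p) (j : ℤ) (n : Lam p), b (u, j, n) =ᵐ[mu p] packet (Ω u) j n) :
    ∀ᵐ ω ∂mu p, ∃ (k : ℤ) (u : Idx p), sigmaPow p k ω ∈ Ω u := by
  set E : Set (Vilenkin p) := (⋃ (k : ℤ) (u : Idx p), sigmaPow p k ⁻¹' Ω u)ᶜ with hE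
  have hEm : MeasurableSet E := (MeasurableSet.iUnion fun k => MeasurableSet.iUnion fun u =>
    (continuous_sigmaPow k).measurable (hΩ u)).compl
  suffices h : mu p E = 0 by
    filter_upwards [measure_eq_zero_iff_ae_notMem.1 h] with ω hω
    rw [hE, notMem_compl_iff] at hω
    simpa using hω
  by_contra hpos
  obtain ⟨A, hAm, hA, hAE⟩ : ∃ A, MeasurableSet A ∧ (0 < mu p A ∧ mu p A < ⊤) ∧ A ⊆ E := by
    obtain ⟨A, hAE, hAm, h0, hT⟩ := Measure.exists_subset_measure_lt_top hEm
      (pos_iff_ne_zero.2 hpos)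
    exact ⟨A, hAE, ⟨h0, hT⟩, hAm⟩
  have hL : MemLp (A.indicator fun _ => (1 : ℂ)) 2 (mu p) := memLp_indicator_const 2 hAm 1
    (Or.inr hA.2.ne)
  have hzero : hL.toLp = 0 := by
    refine b.repr.injective ?_
    rw [map_zero]
    ext ⟨u, k, n⟩
    rw [b.repr_apply_apply, inner_eq_integral_of_ae_eq (hb u k n) hL.coeFn_toLp]
    refine integral_eq_zero_of_ae (Filter.Eventually.of_forall fun ω => ?_)
    by_cases hω : ω ∈ A
    · have : sigmaPow p k ω ∉ Ω u := fun h => hAE hω (mem_iUnion₂.2 ⟨k, u, h⟩)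
      simp [packet_eq_zero_iff.2 this]
    · simp [hω]
  have hA0 : A.indicator (fun _ => (1 : ℂ)) =ᵐ[mu p] 0 :=
    hL.coeFn_toLp.symm.trans ((Lp.eq_zero_iff_ae_eq_zero).1 hzero)
  refine hA.1.ne' (measure_eq_zero_iff_ae_notMem.2 ?_)
  filter_upwards [hA0] with ω hω hωA
  simp [hωA] at hω

end Necessity

omit [NeZero p] in
theorem mem_sigmaPow_image {j : ℤ} {D : Set (Vilenkin p)} {x : Vilenkin p} :
    x ∈ sigmaPow p j '' D ↔ sigmaPow p (-j) x ∈ D := by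
  constructor
  · rintro ⟨y, hy, rfl⟩
    rwa [sigmaPow_eq_rhoPow (-j), neg_neg, rhoPow_sigmaPow]
  · intro h
    refine ⟨sigmaPow p (-j) x, h, ?_⟩
    rw [sigmaPow_eq_rhoPow (-j), neg_neg, sigmaPow_rhoPow]

end Vilenkin

theorem theorem1 (p : ℕ) [NeZero p] (hp : 2 ≤ p)
    (Ω : Vilenkin.Idx p → Set (VilenkinDual p)) (hΩ : ∀ u, MeasurableSet (Ω u)) :
    Vilenkin.IsWaveletSet Ω ↔
      ((∀ (u₁ u₂ : Vilenkin.Idx p) (j k : ℤ), (u₁ ≠ u₂ ∨ j ≠ k) →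
          Vilenkin.mu p ((Vilenkin.sigmaPow p j '' Ω u₁) ∩ (Vilenkin.sigmaPow p k '' Ω u₂)) = 0) ∧
        Vilenkin.mu p (univ \ ⋃ (k : ℤ) (u : Vilenkin.Idx p), Vilenkin.sigmaPow p k '' Ω u) = 0) ∧
      (∀ u : Vilenkin.Idx p,
        Vilenkin.TranslationCongruent (Ω u) (Vilenkin.U p : Set (VilenkinDual p))) := by
  open Vilenkin in
  rw [isWaveletSet_iff hΩ]
  simp_rw [translationCongruent_U_iff (hΩ _)]
  constructor
  · rintro ⟨hfin, b, hb⟩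
    refine ⟨⟨fun u v j k hne => measure_eq_zero_iff_ae_notMem.2 ?_,
      measure_eq_zero_iff_ae_notMem.2 ?_⟩, isAddFundamentalDomain_of_hilbertBasis hΩ hfin hb⟩
    · have hne' : u ≠ v ∨ -j ≠ -k := hne.imp_right neg_injective.ne
      filter_upwards [ae_disjoint_of_hilbertBasis hΩ hfin hb hne'] with ω hω hω'
      exact hω (mem_sigmaPow_image.1 hω'.1) (mem_sigmaPow_image.1 hω'.2)
    · filter_upwards [ae_cover_of_hilbertBasis hΩ hb] with ω hω hω'
      obtain ⟨k, u, h⟩ := hω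
      refine hω'.2 (mem_iUnion₂.2 ⟨-k, u, mem_sigmaPow_image.2 ?_⟩)
      rwa [neg_neg]
  · rintro ⟨⟨hdisj, hcov⟩, hD⟩
    obtain ⟨b, hb⟩ := exists_hilbertBasis_packet (ι := Idx p × ℤ) (D := fun i => Ω i.1)
      (j := fun i => i.2) (fun i => hΩ i.1) (fun i => hD i.1) (by
        rintro ⟨u, j⟩ ⟨v, k⟩ hne
        have hne' : u ≠ v ∨ -j ≠ -k := by
          by_contra! h
          exact hne (Prod.ext h.1 (neg_injective h.2))
        filter_upwards [measure_eq_zero_iff_ae_notMem.1 (hdisj u v (-j) (-k) hne')] with ω hω h₁ h₂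
        refine hω ⟨mem_sigmaPow_image.2 ?_, mem_sigmaPow_image.2 ?_⟩ <;> rwa [neg_neg]) (by
        filter_upwards [measure_eq_zero_iff_ae_notMem.1 hcov] with ω hω
        have hω' : ω ∈ ⋃ (k : ℤ) (u : Idx p), sigmaPow p k '' Ω u := by
          by_contra h
          exact hω ⟨mem_univ _, h⟩
        obtain ⟨k, u, h⟩ := mem_iUnion₂.1 hω'
        exact ⟨(u, -k), mem_sigmaPow_image.1 h⟩)
    obtain ⟨b', hb'⟩ := exists_hilbertBasis_reindex b (Equiv.prodAssoc (Idx p) ℤ (Lam p)).symm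
    refine ⟨fun u => ?_, b', fun u j n => ?_⟩
    · rw [measure_of_isAddFundamentalDomain (hD u)]
      exact ENNReal.one_lt_top
    · rw [hb']
      exact hb (u, j) n
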